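/- Graphs are finite and may have loops and parallel edges. For a graph $H$ let $v(H)$ and $e(H)$ be its numbers of vertices and edges, a loop counting as one edge, and let $\mathrm{mad}(G)=\max\{2e(H)/v(H) : H\subseteq G,\ V(H)\neq\varnothing\}$ be the maximum average degree of $G$ (read as $0$ if $G$ has no vertices). A cycle has length at least $1$: a loop is a cycle of length $1$ and two parallel edges form a cycle of length $2$. A forest is a graph without cycles, and a pseudoforest is a graph in which every connected component contains at most one cycle. A star is a graph $K_{1,m}$ with $m\ge 0$. A graph $G$ decomposes into the graphs $F_1,\dots,F_r$ if these are spanning subgraphs of $G$ whose edge sets (possibly empty) partition $E(G)$. Let $k\ge 0$ and $d\ge 0$ be integers with $d\le k+1$. Then every graph $G$ with $$\mathrm{mad}(G)\le 2\left(k+\frac{d}{d+k+1}\right)$$ decomposes into $k+1$ pseudoforests, one of which, $F$, is a forest such that every connected component $K$ of $F$ satisfies $e(K)\le d$ and is isomorphic to a star. -/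

import Mathlib

namespace Graph

/-- The maximum average degree of a finite (multi)graph: the largest value of `2 e(H) / v(H)` over
all subgraphs `H` with at least one vertex. A loop counts as one edge. For finite graphs with a
vertex the supremum is a maximum (`isGreatest_mad`); it is `0` for the graph without vertices. -/
noncomputable def mad {α β : Type*} (G : Graph α β) : ℝ :=
  sSup {q : ℝ | ∃ H : Graph α β, H ≤ G ∧ V(H).Nonempty ∧
    q = 2 * (E(H).ncard : ℝ) / (V(H).ncard : ℝ)}

theorem isGreatest_mad {α β : Type*} (G : Graph α β) (hV : V(G).Finite) (hE : E(G).Finite)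
    (hne : V(G).Nonempty) :
    IsGreatest {q : ℝ | ∃ H : Graph α β, H ≤ G ∧ V(H).Nonempty ∧
      q = 2 * (E(H).ncard : ℝ) / (V(H).ncard : ℝ)} G.mad := by
  have hfin : {q : ℝ | ∃ H : Graph α β, H ≤ G ∧ V(H).Nonempty ∧
      q = 2 * (E(H).ncard : ℝ) / (V(H).ncard : ℝ)}.Finite := by
    refine ((Set.finite_Iic (E(G).ncard)).image2 (fun a b : ℕ => 2 * (a : ℝ) / (b : ℝ))
      (Set.finite_Iic (V(G).ncard))).subset ?_
    rintro q ⟨H, hH, -, rfl⟩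
    exact ⟨_, Set.ncard_le_ncard hH.edgeSet_mono hE, _,
      Set.ncard_le_ncard hH.vertexSet_mono hV, rfl⟩
  have hnon : {q : ℝ | ∃ H : Graph α β, H ≤ G ∧ V(H).Nonempty ∧
      q = 2 * (E(H).ncard : ℝ) / (V(H).ncard : ℝ)}.Nonempty := ⟨_, G, le_rfl, hne, rfl⟩
  exact ⟨hnon.csSup_mem hfin, fun q hq => le_csSup hfin.bddAbove hq⟩

/-- A graph is connected if it has a vertex and any two vertices are joined by a walk. -/
def IsConnected {α β : Type*} (G : Graph α β) : Prop :=
  V(G).Nonempty ∧ ∀ x ∈ V(G), ∀ y ∈ V(G), Relation.ReflTransGen G.Adj x y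

/-- `K` is a connected component of `G`: a maximal connected subgraph. -/
def IsComponent {α β : Type*} (G K : Graph α β) : Prop :=
  Maximal (fun H : Graph α β => H ≤ G ∧ H.IsConnected) K

/-- `C` is a cycle: for some length `n + 1 ≥ 1`, it consists of distinct vertices `v 0, …, v n` and
distinct edges `e 0, …, e n`, where `e i` joins `v i` to the cyclically next vertex. (Addition in
`Fin (n + 1)` wraps around.) Length `1` is a loop, length `2` a pair of parallel edges. -/
def IsCycle {α β : Type*} (C : Graph α β) : Prop :=
  ∃ (n : ℕ) (v : Fin (n + 1) → α) (e : Fin (n + 1) → β),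
    Function.Injective v ∧ Function.Injective e ∧ V(C) = Set.range v ∧ E(C) = Set.range e ∧
    ∀ i, C.IsLink (e i) (v i) (v (i + 1))

/-- A forest is a graph without cycles. -/
def IsForest {α β : Type*} (G : Graph α β) : Prop :=
  ∀ C : Graph α β, C ≤ G → ¬ C.IsCycle

/-- A pseudoforest is a graph each of whose connected components contains at most one cycle. -/
def IsPseudoforest {α β : Type*} (G : Graph α β) : Prop :=
  ∀ K : Graph α β, G.IsComponent K →
    ∀ C C' : Graph α β, C ≤ K → C' ≤ K → C.IsCycle → C'.IsCycle → C = C'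

/-- `K` is (isomorphic to) a star `K_{1,m}`, `m ≥ 0`: a centre `c`, `m` distinct leaves `x i`
different from `c`, and `m` distinct edges `e i`, where `e i` joins `c` to `x i`. -/
def IsStar {α β : Type*} (K : Graph α β) : Prop :=
  ∃ (m : ℕ) (c : α) (x : Fin m → α) (e : Fin m → β),
    Function.Injective x ∧ (∀ i, x i ≠ c) ∧ Function.Injective e ∧
    V(K) = insert c (Set.range x) ∧ E(K) = Set.range e ∧ ∀ i, K.IsLink (e i) c (x i)

/-- The family `F` is a decomposition of `G`: its members are spanning subgraphs of `G` whose edge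
sets partition the edge set of `G` (parts may be empty). -/
def IsDecomposition {α β ι : Type*} (G : Graph α β) (F : ι → Graph α β) : Prop :=
  (∀ i, F i ≤s G) ∧ ∀ e ∈ E(G), ∃! i, e ∈ E(F i)

end Graph

/-!
# Decomposing a graph into pseudoforests and a forest of small stars

A graph is a pseudoforest if its edges can be oriented with all outdegrees at most one
(`Graph.isPseudoforest_of_injOn`). It therefore suffices to colour some edges red, forming vertex
disjoint stars with at most `d` edges, and to orient the remaining blue edges with outdegrees at
most `k` (`StarColoring.exists_valid`); the blue edges then split into `k` pseudoforests.

Allow each vertex `v` a blue outdegree of up to `c v ≥ k`, with the sum of the capacities `c v`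
minimal, and suppose that `c u > k`. Then `u` attains its capacity in every valid colouring.
Starting from the red component of `u`, list red components such that each is entered by a blue
edge from an earlier one. Among all valid colourings choose one for which the sequence of component
sizes is lexicographically minimal, and the list as long as possible. Then:

* Every listed vertex `y` attains its capacity (`StarColoring.improvable_of_deficient`). Otherwise
  a red edge at `y` could be turned blue, leaving `y`, which makes its component smaller. If there
  is no red edge at `y`, reversing the blue edge that enters `y` moves the spare capacity to an
  earlier component.
* A listed isolated vertex, other than `u`, is entered from a component with `d` edges, and in fact
  from the vertex at which that component is entered itself
  (`StarColoring.eq_and_size_eq_of_not_improvable`). Otherwise an exchange of a red edge with a blue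
  edge improves the sequence. So a component with `d` edges entered at `x` is responsible for at
  most `c x` isolated vertices.

Since the list cannot be extended, no blue edge leaves its vertex set `H`. If `n` components with
`S` edges are listed and `X ≥ 1` is the sum of `c v - k` over `H`, then `H` has `S + n` vertices and
spans at least `k (S + n) + X + S` edges, so the bound on the average degree gives
`(d + k + 1) X + (k + 1) S ≤ d n`. But `d n ≤ (k + 1) S + d X` by discharging
(`StarColoring.Legal.mul_le_sum`): a component with `e > 0` edges has `(k + 1) e ≥ d` at its
disposal, which is where `d ≤ k + 1` enters, and for `e = d` this suffices for itself and `k`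
isolated vertices.
-/

noncomputable section

open Finset
open scoped Classical

/-! ### Coloured orientations -/

/-- An orientation of a set `E` of edges, each running from `tail e` to `head e`, together with a
colouring of the edges in red and blue (not red). Red edges are meant to run from a leaf of a star
to its centre. -/
structure StarColoring (V E : Type*) where
  tail : E → V
  head : E → V
  red : E → Prop

namespace StarColoring

variable {V E : Type*} (C : StarColoring V E)

/-- The red edges form stars with at most `d` edges, each oriented towards the centre: a vertex is
the tail of at most one red edge, a head of a red edge is the tail of none, and at most `d` red
edges share a head. For a star with a single edge, either end may serve as the centre. -/
structure IsStarForest [Fintype E] (d : ℕ) : Prop where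
  tail_inj : ∀ e f, C.red e → C.red f → C.tail e = C.tail f → e = f
  tail_ne_head : ∀ e f, C.red e → C.red f → C.tail e ≠ C.head f
  card_le : ∀ v, #{e | C.red e ∧ C.head e = v} ≤ d

/-- The blue edges leaving `v`. -/
def out [Fintype E] (v : V) : Finset E := {e | ¬ C.red e ∧ C.tail e = v}

/-- The red edges entering `v`; they are the edges of the star centred at `v`. -/
def inRed [Fintype E] (v : V) : Finset E := {e | C.red e ∧ C.head e = v}

/-- The orientation has the prescribed unordered pairs of ends, the red edges form stars with at
most `d` edges, and every vertex `v` has blue outdegree at most its capacity `c v`. -/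
structure Valid [Fintype E] (ends : E → Sym2 V) (c : V → ℕ) (d : ℕ) : Prop where
  ends_eq : ∀ e, s(C.tail e, C.head e) = ends e
  star : C.IsStarForest d
  out_le : ∀ v, #(C.out v) ≤ c v

/-- The centre of the red star containing `v`; a vertex without red edges is its own centre. Two
vertices lie in the same red component exactly if their centres agree. -/
def center (v : V) : V := if h : ∃ e, C.red e ∧ C.tail e = v then C.head h.choose else v

/-- The number of edges of the red star containing `v`. -/
def size [Fintype E] (v : V) : ℕ := #(C.inRed (C.center v))

/-- Reorient `e` from `t` to `h`, and make it red if `r` holds and blue otherwise. -/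
def set (e : E) (t h : V) (r : Prop) : StarColoring V E where
  tail := Function.update C.tail e t
  head := Function.update C.head e h
  red := Function.update C.red e r

section set
variable (e f : E) (t h : V) (r : Prop)
@[simp] lemma set_tail_self : (C.set e t h r).tail e = t := by simp [set]
@[simp] lemma set_head_self : (C.set e t h r).head e = h := by simp [set]
@[simp] lemma set_red_self : (C.set e t h r).red e = r := by simp [set]
variable {e f}
@[simp] lemma set_tail_of_ne (hf : f ≠ e) : (C.set e t h r).tail f = C.tail f := by simp [set, hf]
@[simp] lemma set_head_of_ne (hf : f ≠ e) : (C.set e t h r).head f = C.head f := by simp [set, hf]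
@[simp] lemma set_red_of_ne (hf : f ≠ e) : (C.set e t h r).red f = C.red f := by simp [set, hf]
end set

variable [Fintype E] {C}

@[simp] lemma mem_out {e : E} {v : V} : e ∈ C.out v ↔ ¬ C.red e ∧ C.tail e = v := by simp [out]
@[simp] lemma mem_inRed {e : E} {v : V} : e ∈ C.inRed v ↔ C.red e ∧ C.head e = v := by simp [inRed]

lemma card_out_set (e : E) (t h : V) (r : Prop) (v : V) :
    #((C.set e t h r).out v) + (if ¬ C.red e ∧ C.tail e = v then 1 else 0) =
      #(C.out v) + (if ¬ r ∧ t = v then 1 else 0) := by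
  have key : ((C.set e t h r).out v).erase e = (C.out v).erase e := by
    ext f
    by_cases hf : f = e <;> simp [hf]
  have h1 := card_erase_add_one (s := C.out v) (a := e)
  have h2 := card_erase_add_one (s := (C.set e t h r).out v) (a := e)
  have h3 := erase_eq_of_notMem (s := C.out v) (a := e)
  have h4 := erase_eq_of_notMem (s := (C.set e t h r).out v) (a := e)
  rw [key] at h2 h4
  simp only [mem_out, set_red_self, set_tail_self] at h1 h2 h3 h4
  split_ifs with ha hb hb
  · have := h1 ha; have := h2 hb; omega
  · have := h1 ha; rw [← h4 hb]; omega
  · have := h2 hb; rw [h3 ha] at this; omega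
  · rw [← h4 hb, h3 ha]

lemma card_inRed_set (e : E) (t h : V) (r : Prop) (v : V) :
    #((C.set e t h r).inRed v) + (if C.red e ∧ C.head e = v then 1 else 0) =
      #(C.inRed v) + (if r ∧ h = v then 1 else 0) := by
  have key : ((C.set e t h r).inRed v).erase e = (C.inRed v).erase e := by
    ext f
    by_cases hf : f = e <;> simp [hf]
  have h1 := card_erase_add_one (s := C.inRed v) (a := e)
  have h2 := card_erase_add_one (s := (C.set e t h r).inRed v) (a := e)
  have h3 := erase_eq_of_notMem (s := C.inRed v) (a := e)
  have h4 := erase_eq_of_notMem (s := (C.set e t h r).inRed v) (a := e)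
  rw [key] at h2 h4
  simp only [mem_inRed, set_red_self, set_head_self] at h1 h2 h3 h4
  split_ifs with ha hb hb
  · have := h1 ha; have := h2 hb; omega
  · have := h1 ha; rw [← h4 hb]; omega
  · have := h2 hb; rw [h3 ha] at this; omega
  · rw [← h4 hb, h3 ha]

variable {d : ℕ}

lemma IsStarForest.card_inRed_le (hC : C.IsStarForest d) (v : V) : #(C.inRed v) ≤ d := by
  simpa [inRed] using hC.card_le v

lemma IsStarForest.center_tail (hC : C.IsStarForest d) {e : E} (he : C.red e) :
    C.center (C.tail e) = C.head e := by
  have h : ∃ f, C.red f ∧ C.tail f = C.tail e := ⟨e, he, rfl⟩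
  rw [center, dif_pos h]
  rw [hC.tail_inj _ _ h.choose_spec.1 he h.choose_spec.2]

omit [Fintype E] in
lemma center_of_forall {v : V} (h : ∀ e, C.red e → C.tail e ≠ v) : C.center v = v := by
  rw [center, dif_neg]
  rintro ⟨e, he, hv⟩
  exact h e he hv

lemma IsStarForest.center_head (hC : C.IsStarForest d) {e : E} (he : C.red e) :
    C.center (C.head e) = C.head e :=
  center_of_forall fun f hf => hC.tail_ne_head f e hf he

lemma IsStarForest.center_cases (hC : C.IsStarForest d) (v : V) :
    (∃ e, C.red e ∧ C.tail e = v ∧ C.center v = C.head e) ∨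
      ((∀ e, C.red e → C.tail e ≠ v) ∧ C.center v = v) := by
  by_cases h : ∃ e, C.red e ∧ C.tail e = v
  · obtain ⟨e, he, rfl⟩ := h
    exact .inl ⟨e, he, rfl, hC.center_tail he⟩
  · have h' : ∀ e, C.red e → C.tail e ≠ v := fun e he hv => h ⟨e, he, hv⟩
    exact .inr ⟨h', center_of_forall h'⟩

lemma IsStarForest.center_center (hC : C.IsStarForest d) (v : V) :
    C.center (C.center v) = C.center v := by
  obtain ⟨e, he, -, h⟩ | ⟨-, h⟩ := hC.center_cases v
  · rw [h, hC.center_head he]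
  · rw [h, h]

/-- A component of size zero is a single vertex without red edges. -/
lemma IsStarForest.of_size_eq_zero (hC : C.IsStarForest d) {v : V} (h : C.size v = 0) :
    C.center v = v ∧ ∀ e, C.red e → C.tail e ≠ v ∧ C.head e ≠ v := by
  rw [size, card_eq_zero, eq_empty_iff_forall_notMem] at h
  obtain ⟨e, he, -, h'⟩ | ⟨h1, h2⟩ := hC.center_cases v
  · exact absurd (mem_inRed.2 ⟨he, h'.symm⟩) (h e)
  · exact ⟨h2, fun e he => ⟨h1 e he, fun hv => h e (mem_inRed.2 ⟨he, hv.trans h2.symm⟩)⟩⟩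

lemma IsStarForest.set_blue (hC : C.IsStarForest d) (e : E) (t h : V) :
    (C.set e t h False).IsStarForest d where
  tail_inj f g hf hg := by
    have h1 : f ≠ e := by rintro rfl; simp at hf
    have h2 : g ≠ e := by rintro rfl; simp at hg
    simp only [ne_eq, h1, not_false_eq_true, set_red_of_ne, h2, set_tail_of_ne] at *
    exact hC.tail_inj f g hf hg
  tail_ne_head f g hf hg := by
    have h1 : f ≠ e := by rintro rfl; simp at hf
    have h2 : g ≠ e := by rintro rfl; simp at hg
    simp only [ne_eq, h1, not_false_eq_true, set_red_of_ne, h2, set_tail_of_ne,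
      set_head_of_ne] at *
    exact hC.tail_ne_head f g hf hg
  card_le v := by
    have := card_inRed_set (C := C) e t h False v
    have := hC.card_inRed_le v
    simp only [false_and, if_false] at *
    change #((C.set e t h False).inRed v) ≤ d
    omega

lemma IsStarForest.set_red (hC : C.IsStarForest d) {e : E} {t h : V} (he : ¬ C.red e)
    (hth : t ≠ h) (ht : ∀ f, C.red f → C.tail f ≠ t ∧ C.head f ≠ t)
    (hh : ∀ f, C.red f → C.tail f ≠ h) (hd : #(C.inRed h) < d) :
    (C.set e t h True).IsStarForest d where
  tail_inj f g hf hg := by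
    by_cases h1 : f = e <;> by_cases h2 : g = e <;>
      simp only [h1, h2, ne_eq, not_false_eq_true, set_red_of_ne, set_tail_of_ne,
        set_tail_self] at *
    · simp
    · exact fun hh => absurd hh.symm (ht g hg).1
    · exact fun hh => absurd hh (ht f hf).1
    · exact hC.tail_inj f g hf hg
  tail_ne_head f g hf hg := by
    by_cases h1 : f = e <;> by_cases h2 : g = e <;>
      simp only [h1, h2, ne_eq, not_false_eq_true, set_red_of_ne, set_tail_of_ne,
        set_tail_self, set_head_of_ne, set_head_self] at *
    · exact hth
    · exact fun hh => absurd hh.symm (ht g hg).2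
    · exact hh f hf
    · exact hC.tail_ne_head f g hf hg
  card_le v := by
    have h1 := card_inRed_set (C := C) e t h True v
    have h2 := hC.card_inRed_le v
    change #((C.set e t h True).inRed v) ≤ d
    simp only [he, false_and, if_false, true_and] at h1
    split_ifs at h1 with hv
    · subst hv; omega
    · omega

/-! ### Legal orders of red components -/

/-- `v` lies in the red component of one of the first `n` entry vertices. -/
def Reached (C : StarColoring V E) (x : ℕ → V) (n : ℕ) (v : V) : Prop :=
  ∃ m < n, C.center v = C.center (x m)

/-- The red components of `x 0, …, x (n - 1)` are distinct and form a legal order: every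
component after the first is entered at `x i` by a blue edge from an earlier component. -/
structure Legal (C : StarColoring V E) (x : ℕ → V) (n : ℕ) : Prop where
  not_reached : ∀ i < n, ¬ C.Reached x i (x i)
  link : ∀ i < n, 0 < i → ∃ e, ¬ C.red e ∧ C.head e = x i ∧ C.Reached x i (C.tail e)

omit [Fintype E] in
lemma Legal.mono {x : ℕ → V} {m n : ℕ} (h : C.Legal x n) (hmn : m ≤ n) : C.Legal x m :=
  ⟨fun i hi => h.not_reached i (hi.trans_le hmn), fun i hi => h.link i (hi.trans_le hmn)⟩

omit [Fintype E] in
lemma Legal.ne {x : ℕ → V} {n i j : ℕ} (h : C.Legal x n) (hi : i < n) (hj : j < n) (hij : i ≠ j) :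
    C.center (x i) ≠ C.center (x j) := by
  rcases lt_or_gt_of_ne hij with h' | h'
  · exact fun hc => h.not_reached j hj ⟨i, h', hc.symm⟩
  · exact fun hc => h.not_reached i hi ⟨j, h', hc⟩

variable {ends : E → Sym2 V} {c : V → ℕ}

/-- A legal order of `n + 1` components survives a change of the colouring, with the first `n`
components and their sizes unchanged, if every changed edge satisfies two conditions: if it is red
before or after, it avoids the first `n` components; if it is blue before, it enters none of the
entry vertices `x 0, …, x n`. -/
lemma Legal.transfer {C' : StarColoring V E} {x : ℕ → V} {n : ℕ}
    (hC : C.Valid ends c d) (hC' : C'.Valid ends c d) (hL : C.Legal x (n + 1))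
    (hchg : ∀ e, (C'.tail e = C.tail e ∧ C'.head e = C.head e ∧ (C'.red e ↔ C.red e)) ∨
      ((C.red e ∨ C'.red e → ¬ C.Reached x n (C.tail e) ∧ ¬ C.Reached x n (C.head e)) ∧
        (¬ C.red e → ∀ i ≤ n, C.head e ≠ x i))) :
    C'.Legal x (n + 1) ∧ ∀ m < n, C'.size (x m) = C.size (x m) := by
  have hS := hC.star
  have hS' := hC'.star
  have hends : ∀ e, (C'.tail e = C.tail e ∧ C'.head e = C.head e) ∨
      (C'.tail e = C.head e ∧ C'.head e = C.tail e) := fun e => by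
    have := (hC'.ends_eq e).trans (hC.ends_eq e).symm
    simpa [Sym2.eq_iff] using this
  have hctr : ∀ v, C.Reached x n v → C'.center v = C.center v := by
    intro v hv
    obtain ⟨e, he, hev, h⟩ | ⟨h1, h⟩ := hS.center_cases v
    · obtain ⟨h3, h4, h5⟩ | ⟨h3, -⟩ := hchg e
      · rw [h, ← hev, ← h3, hS'.center_tail (h5.2 he), h4]
      · exact absurd (hev ▸ hv) (h3 (.inl he)).1
    · obtain ⟨e, he, hev, h'⟩ | ⟨h1', h'⟩ := hS'.center_cases v
      · obtain ⟨h3, h4, h5⟩ | ⟨h3, -⟩ := hchg e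
        · exact absurd (h3 ▸ hev) (h1 e (h5.1 he))
        · have h6 := h3 (.inr he)
          rcases hends e with h7 | h7
          · rw [h7.1] at hev; exact absurd (hev ▸ hv) h6.1
          · rw [h7.1] at hev; exact absurd (hev ▸ hv) h6.2
      · rw [h, h']
  have hctr' : ∀ v, ¬ C.Reached x n v → ∀ m < n, C'.center v ≠ C.center (x m) := by
    intro v hv m hm hvm
    have hz : C.Reached x n (C.center (x m)) := ⟨m, hm, hS.center_center _⟩
    obtain ⟨e, he, hev, h⟩ | ⟨h1, h⟩ := hS'.center_cases v
    · obtain ⟨h3, h4, h5⟩ | ⟨h3, -⟩ := hchg e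
      · refine hv ⟨m, hm, ?_⟩
        rw [← hvm, h, ← hev, h3, h4, hS.center_tail (h5.1 he)]
      · have h6 := h3 (.inr he)
        rw [← hvm, h] at hz
        rcases hends e with h7 | h7
        · rw [h7.2] at hz; exact h6.2 hz
        · rw [h7.2] at hz; exact h6.1 hz
    · rw [← hvm, h] at hz; exact hv hz
  have hx : ∀ m < n, C'.center (x m) = C.center (x m) := fun m hm => hctr _ ⟨m, hm, rfl⟩
  refine ⟨⟨?_, ?_⟩, ?_⟩
  · rintro i hi ⟨m, hm, h⟩
    rw [hx m (by omega)] at h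
    by_cases hin : C.Reached x n (x i)
    · rw [hctr _ hin] at h
      exact hL.not_reached i hi ⟨m, hm, h⟩
    · exact hctr' _ hin m (by omega) h
  · intro i hi hi0
    obtain ⟨e, he, hex, m, hm, hem⟩ := hL.link i hi hi0
    obtain ⟨h3, h4, h5⟩ | ⟨-, h3⟩ := hchg e
    · refine ⟨e, by rwa [h5], h4.trans hex, m, hm, ?_⟩
      rw [h3, hx m (by omega), ← hem]
      exact hctr _ ⟨m, by omega, hem⟩
    · exact absurd hex (h3 he i (by omega))
  · intro m hm
    have hz : C.Reached x n (C.center (x m)) := ⟨m, hm, hS.center_center _⟩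
    rw [size, size, hx m hm]
    congr 1
    ext e
    simp only [mem_inRed]
    obtain ⟨h3, h4, h5⟩ | ⟨h3, -⟩ := hchg e
    · rw [h5, h4]
    · constructor
      · rintro ⟨he, heq⟩
        have h6 := h3 (.inr he)
        rw [← heq] at hz
        rcases hends e with h7 | h7
        · rw [h7.2] at hz; exact absurd hz h6.2
        · rw [h7.2] at hz; exact absurd hz h6.1
      · rintro ⟨he, heq⟩
        rw [← heq] at hz
        exact absurd hz (h3 (.inl he)).2

end StarColoring

namespace StarColoring

variable {V E : Type*} {C : StarColoring V E} {d : ℕ}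
  {ends : E → Sym2 V} {c : V → ℕ}

/-! ### Exchanges -/

lemma ends_set {e : E} {t h : V} {r : Prop} (hC : ∀ f, s(C.tail f, C.head f) = ends f)
    (hth : s(t, h) = ends e) (f : E) :
    s((C.set e t h r).tail f, (C.set e t h r).head f) = ends f := by
  by_cases hf : f = e
  · subst hf; simpa using hth
  · simpa [hf] using hC f

lemma red_of_set_blue {e f : E} {t h : V} (hf : (C.set e t h False).red f) :
    f ≠ e ∧ C.red f := by
  have hfe : f ≠ e := by rintro rfl; simp at hf
  exact ⟨hfe, by simpa [hfe] using hf⟩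

variable [Fintype E]

/-- A vertex that is no centre is the centre of no other vertex. -/
lemma IsStarForest.eq_of_center_eq (hC : C.IsStarForest d) {v w : V}
    (hw : ∀ f, C.red f → C.head f ≠ w) (h : C.center v = w) : v = w := by
  obtain ⟨f, hf, -, h'⟩ | ⟨-, h'⟩ := hC.center_cases v
  · exact absurd (h'.symm.trans h) (hw f hf)
  · exact h'.symm.trans h

lemma IsStarForest.not_reached_of_isolated (hC : C.IsStarForest d) {x : ℕ → V} {n : ℕ} {w : V}
    (hw : ∀ f, C.red f → C.tail f ≠ w ∧ C.head f ≠ w) (hx : ∀ m < n, x m ≠ w) :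
    ¬ C.Reached x n w := by
  rintro ⟨m, hm, h⟩
  rw [center_of_forall fun f hf => (hw f hf).1] at h
  exact hx m hm (hC.eq_of_center_eq (fun f hf => (hw f hf).2) h.symm)

lemma IsStarForest.center_set_blue (hC : C.IsStarForest d) {e : E} {v : V} (t h : V)
    (hv : C.red e → C.tail e ≠ v) : (C.set e t h False).center v = C.center v := by
  obtain ⟨f, hf, rfl, h'⟩ | ⟨h1, h'⟩ := hC.center_cases v
  · have hfe : f ≠ e := by rintro rfl; exact hv hf rfl
    have := (hC.set_blue e t h).center_tail (e := f) (by simpa [hfe] using hf)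
    simp only [ne_eq, hfe, not_false_eq_true, set_tail_of_ne, set_head_of_ne] at this
    rw [this, h']
  · rw [h', center_of_forall]
    intro f hf
    have hfe : f ≠ e := by rintro rfl; simp at hf
    simp only [ne_eq, hfe, not_false_eq_true, set_red_of_ne, set_tail_of_ne] at *
    exact h1 f hf

lemma IsStarForest.center_set_blue_tail (hC : C.IsStarForest d) {e : E} (t h : V)
    (he : C.red e) : (C.set e t h False).center (C.tail e) = C.tail e := by
  rw [center_of_forall]
  intro f hf
  have hfe : f ≠ e := by rintro rfl; simp at hf
  simp only [ne_eq, hfe, not_false_eq_true, set_red_of_ne, set_tail_of_ne] at hf ⊢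
  exact fun h => hfe (hC.tail_inj f e hf he h)

lemma IsStarForest.center_set_red {e : E} {t h : V}
    (hC : (C.set e t h True).IsStarForest d) : (C.set e t h True).center t = h := by
  have := hC.center_tail (e := e) (by simp)
  simpa using this

lemma IsStarForest.center_set_red_of_ne (hC : C.IsStarForest d) {e : E} {t h v : V}
    (hC' : (C.set e t h True).IsStarForest d) (he : ¬ C.red e) (hv : v ≠ t) :
    (C.set e t h True).center v = C.center v := by
  obtain ⟨f, hf, rfl, h'⟩ | ⟨h1, h'⟩ := hC.center_cases v
  · have hfe : f ≠ e := by rintro rfl; exact he hf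
    have := hC'.center_tail (e := f) (by simpa [hfe] using hf)
    simp only [ne_eq, hfe, not_false_eq_true, set_tail_of_ne, set_head_of_ne] at this
    rw [this, h']
  · rw [h', center_of_forall]
    intro f hf
    by_cases hfe : f = e
    · subst hfe; simpa using hv.symm
    · simp only [ne_eq, hfe, not_false_eq_true, set_red_of_ne, set_tail_of_ne] at *
      exact h1 f hf

lemma IsStarForest.inRed_tail (hC : C.IsStarForest d) {e : E} (he : C.red e) :
    #(C.inRed (C.tail e)) = 0 := by
  rw [card_eq_zero, eq_empty_iff_forall_notMem]
  intro f hf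
  rw [mem_inRed] at hf
  exact hC.tail_ne_head e f he hf.1 hf.2.symm

lemma inRed_pos {e : E} (he : C.red e) : 0 < #(C.inRed (C.head e)) :=
  card_pos.2 ⟨e, mem_inRed.2 ⟨he, rfl⟩⟩

lemma IsStarForest.size_set_blue_lt (hC : C.IsStarForest d) {e : E} {v : V} (t h : V)
    (he : C.red e) (hv : C.center v = C.head e) :
    (C.set e t h False).size v < C.size v := by
  have hpos := inRed_pos he
  have hle := card_inRed_set (C := C) e t h False
  simp only [false_and, if_false, add_zero, he, true_and] at hle
  by_cases hvt : v = C.tail e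
  · subst hvt
    have := hle (C.tail e)
    rw [hC.inRed_tail he] at this
    rw [size, size, hC.center_set_blue_tail t h he, hv]
    omega
  · have := hle (C.head e)
    rw [size, size, hC.center_set_blue t h (fun _ => Ne.symm hvt), hv]
    simp only [if_true] at this
    omega

/-- For some index `i < n`, there is a valid colouring in which `x 0, …, x i` still enter a legal
order of components, with the same sizes as in `C` before `i` and a smaller one at `i`. -/
def Improvable (ends : E → Sym2 V) (c : V → ℕ) (d : ℕ) (C : StarColoring V E) (x : ℕ → V)
    (n : ℕ) : Prop :=
  ∃ i < n, ∃ C' : StarColoring V E, C'.Valid ends c d ∧ C'.Legal x (i + 1) ∧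
    (∀ m < i, C'.size (x m) = C.size (x m)) ∧ C'.size (x i) < C.size (x i)

lemma Improvable.of_eq {C' : StarColoring V E} {x : ℕ → V} {m n : ℕ}
    (h : C'.Improvable ends c d x m) (hmn : m ≤ n) (hs : ∀ i < m, C'.size (x i) = C.size (x i)) :
    C.Improvable ends c d x n := by
  obtain ⟨i, hi, D, h1, h2, h3, h4⟩ := h
  exact ⟨i, by omega, D, h1, h2, fun m hm => (h3 m hm).trans (hs m (by omega)), hs i hi ▸ h4⟩

variable {x : ℕ → V} {u : V}

omit [Fintype E] in
lemma Legal.not_reached_of_eq {n : ℕ} (hL : C.Legal x (n + 1)) {v : V}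
    (hv : C.center v = C.center (x n)) : ¬ C.Reached x n v := by
  rintro ⟨m, hm, h⟩
  exact hL.not_reached n (by omega) ⟨m, hm, hv.symm.trans h⟩

/-- Suppose that an entry vertex `x j` has spare capacity. Reversing the blue edge by which `x j` is
entered moves the spare capacity to an earlier component. The first entry vertex has none
to spare, by `hroot`. -/
lemma improvable_of_entry_deficient {j : ℕ}
    (IH : ∀ i < j, ∀ C : StarColoring V E, C.Valid ends c d → C.Legal x (i + 1) →
      ∀ y, C.center y = C.center (x i) → #(C.out y) < c y → C.Improvable ends c d x (i + 1))
    (hroot : ∀ C : StarColoring V E, C.Valid ends c d → c (x 0) ≤ #(C.out (x 0)))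
    (hC : C.Valid ends c d) (hL : C.Legal x (j + 1)) (hy : #(C.out (x j)) < c (x j)) :
    C.Improvable ends c d x j := by
  rcases Nat.eq_zero_or_pos j with rfl | hj
  · exact absurd (hroot C hC) (by omega)
  obtain ⟨e, he, hex, i, hi, hei⟩ := hL.link j (by omega) hj
  have hS := hC.star
  have hcen : ∀ v, (C.set e (x j) (C.tail e) False).center v = C.center v := fun v =>
    hS.center_set_blue _ _ (fun h => absurd h he)
  have hsize : ∀ v, (C.set e (x j) (C.tail e) False).size v = C.size v := by
    intro v
    have := card_inRed_set (C := C) e (x j) (C.tail e) False (C.center v)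
    simp only [he, false_and, if_false, add_zero] at this
    rw [size, size, hcen, this]
  have hout : ∀ v, _ := fun v => card_out_set (C := C) e (x j) (C.tail e) False v
  simp only [he, not_false_eq_true, true_and] at hout
  have hV : (C.set e (x j) (C.tail e) False).Valid ends c d := by
    refine ⟨ends_set hC.ends_eq ?_, hS.set_blue _ _ _, fun v => ?_⟩
    · rw [← hC.ends_eq e, hex, Sym2.eq_swap]
    · have h1 := hout v
      have h2 := hC.out_le v
      by_cases hv : x j = v
      · subst hv; rw [if_pos rfl] at h1; omega
      · rw [if_neg hv] at h1; omega
  obtain ⟨hL', -⟩ := (hL.mono (by omega : i + 1 ≤ j + 1)).transfer hC hV (fun f => by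
    by_cases hf : f = e
    · subst hf
      refine .inr ⟨by simp [he], fun _ i' hi' h => ?_⟩
      rw [hex] at h
      exact hL.ne (by omega : j < j + 1) (by omega : i' < j + 1) (by omega) (by rw [h])
    · simp [hf])
  refine (IH i hi _ hV hL' (C.tail e) (by rw [hcen, hcen, hei]) ?_).of_eq (by omega)
    (fun m _ => hsize _)
  have h1 := hout (C.tail e)
  have h2 := hC.out_le (C.tail e)
  have h3 : x j ≠ C.tail e := fun h => hL.not_reached j (by omega) ⟨i, hi, h ▸ hei⟩
  rw [if_pos rfl, if_neg h3] at h1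
  omega

/-- A vertex `y` with spare capacity in a nontrivial component allows a red edge at `y` to become
blue and leave `y`, which makes the component smaller. In a trivial component, `y` is the entry
vertex, and the spare capacity moves to an earlier component. -/
lemma improvable_of_deficient
    (hroot : ∀ C : StarColoring V E, C.Valid ends c d → c (x 0) ≤ #(C.out (x 0))) (j : ℕ) :
    ∀ C : StarColoring V E, C.Valid ends c d → C.Legal x (j + 1) →
      ∀ y, C.center y = C.center (x j) → #(C.out y) < c y → C.Improvable ends c d x (j + 1) := by
  induction j using Nat.strong_induction_on with
  | _ j IH =>
  intro C hC hL y hy hlt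
  have hS := hC.star
  rcases Nat.eq_zero_or_pos (C.size (x j)) with h0 | hpos
  · have hxj := hS.of_size_eq_zero h0
    have : y = x j := by
      obtain ⟨e, he, -, h⟩ | ⟨-, h⟩ := hS.center_cases y
      · exact absurd (by rw [← h, hy, hxj.1]) (hxj.2 e he).2
      · rw [← h, hy, hxj.1]
    subst this
    exact (improvable_of_entry_deficient IH hroot hC hL hlt).of_eq (by omega) (fun _ _ => rfl)
  · obtain ⟨e, y', he, hey, hec⟩ : ∃ e y', C.red e ∧ s(y, y') = ends e ∧
        C.center (x j) = C.head e := by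
      obtain ⟨e, he, hey, h⟩ | ⟨-, h⟩ := hS.center_cases y
      · exact ⟨e, C.head e, he, by rw [← hC.ends_eq e, hey], by rw [← h, hy]⟩
      · obtain ⟨e, he⟩ := card_pos.1 hpos
        rw [mem_inRed] at he
        exact ⟨e, C.tail e, he.1, by rw [← hC.ends_eq e, he.2, ← hy, h, Sym2.eq_swap], he.2.symm⟩
    have hV : (C.set e y y' False).Valid ends c d := by
      refine ⟨ends_set hC.ends_eq hey, hS.set_blue _ _ _, fun v => ?_⟩
      have h1 := card_out_set (C := C) e y y' False v
      have h2 := hC.out_le v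
      simp only [he, not_true_eq_false, false_and, if_false, not_false_eq_true, true_and] at h1
      by_cases hv : y = v
      · subst hv; rw [if_pos rfl] at h1; omega
      · rw [if_neg hv] at h1; omega
    obtain ⟨hL', hs⟩ := hL.transfer hC hV (fun f => by
      by_cases hf : f = e
      · subst hf
        exact .inr ⟨fun _ => ⟨hL.not_reached_of_eq ((hS.center_tail he).trans hec.symm),
          hL.not_reached_of_eq ((hS.center_head he).trans hec.symm)⟩, fun h => absurd he h⟩
      · simp [hf])
    exact ⟨j, by omega, _, hV, hL', hs, hS.size_set_blue_lt _ _ he hec⟩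

lemma improvable_of_entry_deficient'
    (hroot : ∀ C : StarColoring V E, C.Valid ends c d → c (x 0) ≤ #(C.out (x 0))) {j : ℕ}
    (hC : C.Valid ends c d) (hL : C.Legal x (j + 1)) (hy : #(C.out (x j)) < c (x j)) :
    C.Improvable ends c d x j :=
  improvable_of_entry_deficient (fun i _ => improvable_of_deficient hroot i) hroot hC hL hy

/-- Suppose that a blue edge `e` joins the entry vertex `x j` to a vertex without red edges. If
`x j` is the centre of a star with fewer than `d` edges, then `e` can become red. The star grows,
but `x j` obtains spare capacity, so an earlier component can be made smaller. -/
lemma improvable_of_isolated_of_center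
    (hroot : ∀ C : StarColoring V E, C.Valid ends c d → c (x 0) ≤ #(C.out (x 0))) {j : ℕ}
    (hC : C.Valid ends c d) (hL : C.Legal x (j + 1)) {e : E} (he : ¬ C.red e)
    (het : C.tail e = x j) (hcen : C.center (x j) = x j)
    (hw : ∀ f, C.red f → C.tail f ≠ C.head e ∧ C.head f ≠ C.head e)
    (hwx : ∀ m < j + 1, x m ≠ C.head e) (hsize : C.size (x j) < d) :
    C.Improvable ends c d x j := by
  have hS := hC.star
  have hwr := hS.not_reached_of_isolated hw hwx
  have hne : C.head e ≠ x j := fun h => hwx j (by omega) h.symm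
  have hS' : (C.set e (C.head e) (x j) True).IsStarForest d := by
    refine hS.set_red he hne hw (fun f hf h => ?_) (by rwa [size, hcen] at hsize)
    have := hS.center_tail hf
    rw [h, hcen] at this
    exact hS.tail_ne_head f f hf hf (h.trans this)
  have hout : ∀ v, _ := fun v => card_out_set (C := C) e (C.head e) (x j) True v
  simp only [he, not_false_eq_true, true_and, not_true_eq_false, false_and, if_false,
    add_zero, het] at hout
  have hV : (C.set e (C.head e) (x j) True).Valid ends c d := by
    refine ⟨ends_set hC.ends_eq ?_, hS', fun v => ?_⟩
    · rw [← hC.ends_eq e, het, Sym2.eq_swap]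
    · have := hout v
      have := hC.out_le v
      omega
  obtain ⟨hL', hs⟩ := hL.transfer hC hV (fun f => by
    by_cases hf : f = e
    · subst hf
      refine .inr ⟨fun _ => ⟨hL.not_reached_of_eq (by rw [het]), ?_⟩, fun _ i hi h => ?_⟩
      · rintro ⟨m, hm, h⟩; exact hwr ⟨m, by omega, h⟩
      · exact hwr ⟨i, by omega, by rw [h]⟩
    · simp [hf])
  refine (improvable_of_entry_deficient' hroot hV hL' ?_).of_eq le_rfl hs
  have := hout (x j)
  have := hC.out_le (x j)
  rw [if_pos rfl] at *
  omega

/-- Turning the red edge `g` blue and the blue edge `e` red leaves all blue outdegrees unchanged if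
`g` is made to leave the tail of `e`. -/
lemma Valid.exchange (hC : C.Valid ends c d) {e g : E} (he : ¬ C.red e) (hg : C.red g)
    {g' e' e'' : V} (hg' : s(C.tail e, g') = ends g)
    (hee : s(e', e'') = ends e)
    (hS : ((C.set g (C.tail e) g' False).set e e' e'' True).IsStarForest d) :
    ((C.set g (C.tail e) g' False).set e e' e'' True).Valid ends c d := by
  have hge : e ≠ g := by rintro rfl; exact he hg
  refine ⟨ends_set (ends_set hC.ends_eq hg') hee, hS, fun v => ?_⟩
  have h1 := card_out_set (C := C) g (C.tail e) g' False v
  have h2 := card_out_set (C := C.set g (C.tail e) g' False) e e' e'' True v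
  have h3 := hC.out_le v
  simp only [hg, he, hge, ne_eq, not_false_eq_true, set_red_of_ne, set_tail_of_ne,
    not_true_eq_false, false_and, true_and, if_false, add_zero] at h1 h2
  omega

/-- If `e` joins a leaf to a vertex without red edges, then `e` can replace the red edge `g` at
this leaf, becoming a star of its own. -/
lemma Valid.exchange_of_leaf (hC : C.Valid ends c d) (hd : 0 < d) {e g : E} (he : ¬ C.red e)
    (hg : C.red g) (hge : C.tail g = C.tail e)
    (hw : ∀ f, C.red f → C.tail f ≠ C.head e ∧ C.head f ≠ C.head e) :
    ((C.set g (C.tail e) (C.head g) False).set e (C.tail e) (C.head e) True).Valid ends c d := by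
  have hS := hC.star
  refine hC.exchange he hg (by rw [← hC.ends_eq, hge]) (hC.ends_eq e) ?_
  have hne : e ≠ g := by rintro rfl; exact he hg
  refine (hS.set_blue _ _ _).set_red (by simpa [hne] using he) ?_ ?_ ?_ ?_
  · rw [← hge]; exact (hw g hg).1
  · intro f hf
    obtain ⟨hfg, hf⟩ := red_of_set_blue hf
    rw [set_tail_of_ne _ _ _ _ hfg, set_head_of_ne _ _ _ _ hfg, ← hge]
    exact ⟨fun h => hfg (hS.tail_inj f g hf hg h), (hS.tail_ne_head g f hg hf).symm⟩
  · intro f hf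
    obtain ⟨hfg, hf⟩ := red_of_set_blue hf
    rw [set_tail_of_ne _ _ _ _ hfg]
    exact (hw f hf).1
  · rw [card_eq_zero.2]
    · exact hd
    · rw [eq_empty_iff_forall_notMem]
      intro f hf
      rw [mem_inRed] at hf
      obtain ⟨hfg, hf1⟩ := red_of_set_blue hf.1
      rw [set_head_of_ne _ _ _ _ hfg] at hf
      exact (hw f hf1).2 hf.2

/-- If a star has a single edge `g`, either end of `g` may serve as its centre. -/
lemma Valid.swap (hC : C.Valid ends c d) (hd : 0 < d) {g : E} (hg : C.red g)
    (hg1 : #(C.inRed (C.head g)) = 1) :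
    let C' := (C.set g (C.tail g) (C.head g) False).set g (C.head g) (C.tail g) True
    C'.Valid ends c d ∧ C'.center (C.tail g) = C.tail g ∧ C'.size (C.tail g) = 1 := by
  intro C'
  have hS := hC.star
  have hS1 := hS.set_blue g (C.tail g) (C.head g)
  have h1 := card_inRed_set (C := C) g (C.tail g) (C.head g) False (C.tail g)
  have h2 := card_inRed_set (C := C.set g (C.tail g) (C.head g) False) g (C.head g) (C.tail g)
    True (C.tail g)
  simp only [hS.inRed_tail hg, hg, set_red_self, false_and, true_and, if_false, if_true, add_zero,
    (hS.tail_ne_head g g hg hg).symm] at h1 h2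
  have honly : ∀ f, C.red f → C.head f = C.head g → f = g := fun f hf hfg =>
    card_le_one.1 hg1.le f (mem_inRed.2 ⟨hf, hfg⟩) g (mem_inRed.2 ⟨hg, rfl⟩)
  have hSr : C'.IsStarForest d := by
    refine hS1.set_red (by simp) (hS.tail_ne_head g g hg hg).symm ?_ ?_ (by omega)
    · intro f hf
      obtain ⟨hfg, hf⟩ := red_of_set_blue hf
      rw [set_tail_of_ne _ _ _ _ hfg, set_head_of_ne _ _ _ _ hfg]
      exact ⟨hS.tail_ne_head f g hf hg, fun h => hfg (honly f hf h)⟩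
    · intro f hf
      obtain ⟨hfg, hf⟩ := red_of_set_blue hf
      rw [set_tail_of_ne _ _ _ _ hfg]
      exact fun h => hfg (hS.tail_inj f g hf hg h)
  have hcen : C'.center (C.tail g) = C.tail g := by
    rw [hS1.center_set_red_of_ne hSr (by simp) (hS.tail_ne_head g g hg hg)]
    exact hS.center_set_blue_tail _ _ hg
  refine ⟨⟨ends_set (ends_set hC.ends_eq (hC.ends_eq g)) ?_, hSr, fun v => ?_⟩, hcen, ?_⟩
  · rw [Sym2.eq_swap, hC.ends_eq]
  · have h3 := card_out_set (C := C) g (C.tail g) (C.head g) False v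
    have h4 := card_out_set (C := C.set g (C.tail g) (C.head g) False) g (C.head g)
      (C.tail g) True v
    have h5 := hC.out_le v
    simp only [hg, set_red_self, set_tail_self, not_false_eq_true,
      not_true_eq_false, false_and, true_and, if_false, add_zero] at h3 h4
    change #(((C.set g (C.tail g) (C.head g) False).set g (C.head g) (C.tail g) True).out v) ≤ _
    omega
  · rw [size, hcen]
    exact h2.trans (by rw [h1])

/-- An exchange of a red edge of the component of `x j` with a blue edge from this component to a
component outside the order keeps the order legal up to `x j`. -/
lemma Legal.transfer_exchange {j : ℕ} (hC : C.Valid ends c d) (hL : C.Legal x (j + 1))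
    {e g : E} (hg : C.red g) (hgj : C.head g = C.center (x j))
    (hej : C.center (C.tail e) = C.center (x j)) (hwr : ¬ C.Reached x (j + 1) (C.head e))
    {t h t' h' : V} {r r' : Prop}
    (hV : ((C.set g t h r).set e t' h' r').Valid ends c d) :
    ((C.set g t h r).set e t' h' r').Legal x (j + 1) ∧
      ∀ m < j, ((C.set g t h r).set e t' h' r').size (x m) = C.size (x m) := by
  have hS := hC.star
  refine hL.transfer hC hV fun f => ?_
  by_cases hfe : f = e
  · subst hfe
    refine .inr ⟨fun _ => ⟨hL.not_reached_of_eq hej, ?_⟩, fun _ i hi h => ?_⟩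
    · rintro ⟨m, hm, h⟩; exact hwr ⟨m, by omega, h⟩
    · exact hwr ⟨i, by omega, by rw [h]⟩
  · by_cases hfg : f = g
    · subst hfg
      exact .inr ⟨fun _ => ⟨hL.not_reached_of_eq ((hS.center_tail hg).trans hgj),
        hL.not_reached_of_eq ((hS.center_head hg).trans hgj)⟩, fun h => absurd hg h⟩
    · simp [hfe, hfg]

/-- If no improvement is possible, a blue edge from the component of `x j` to a vertex without
red edges starts at the entry vertex `x j` itself, and this component has exactly `d` edges. -/
lemma eq_and_size_eq_of_not_improvable
    (hroot : ∀ C : StarColoring V E, C.Valid ends c d → c (x 0) ≤ #(C.out (x 0))) {j : ℕ}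
    (hC : C.Valid ends c d) (hL : C.Legal x (j + 1)) (hd : 0 < d) {e : E} (he : ¬ C.red e)
    (hej : C.center (C.tail e) = C.center (x j))
    (hw : ∀ f, C.red f → C.tail f ≠ C.head e ∧ C.head f ≠ C.head e)
    (hwx : ∀ m < j + 1, x m ≠ C.head e) (hI : ¬ C.Improvable ends c d x (j + 1)) :
    C.tail e = x j ∧ C.size (x j) = d := by
  have hS := hC.star
  have hwr := hS.not_reached_of_isolated hw hwx
  have hwj : x j ≠ C.head e := hwx j (by omega)
  have hwp : C.tail e ≠ C.head e := fun h => hwr ⟨j, by omega, by rw [← hej, h]⟩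
  have hle : C.size (x j) ≤ d := hS.card_inRed_le _
  have hinw : #(C.inRed (C.head e)) = 0 := by
    rw [card_eq_zero, eq_empty_iff_forall_notMem]
    intro f hf
    rw [mem_inRed] at hf
    exact (hw f hf.1).2 hf.2
  obtain ⟨g, hg, hge, hgc⟩ | ⟨hp, hpc⟩ := hS.center_cases (C.tail e)
  -- the tail of `e` is a leaf, attached to its centre by `g`: replace `g` by `e`
  · have hne : e ≠ g := by rintro rfl; exact he hg
    have hgj : C.head g = C.center (x j) := by rw [← hgc, hej]
    have hzw : C.head e ≠ C.head g := ((hw g hg).2).symm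
    have hV := hC.exchange_of_leaf hd he hg hge hw
    have hS1 := hS.set_blue g (C.tail e) (C.head g)
    obtain ⟨hL', hs⟩ := hL.transfer_exchange hC hg hgj hej hwr hV
    have he1 : ¬ (C.set g (C.tail e) (C.head g) False).red e := by simpa [hne] using he
    have h1 := card_inRed_set (C := C) g (C.tail e) (C.head g) False
    have h2 := card_inRed_set (C := C.set g (C.tail e) (C.head g) False) e (C.tail e)
      (C.head e) True
    simp only [he1, hg, false_and, true_and, if_false, add_zero] at h1 h2
    have hnimp : ¬ ((C.set g (C.tail e) (C.head g) False).set e (C.tail e) (C.head e)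
        True).size (x j) < C.size (x j) := fun h => hI ⟨j, by omega, _, hV, hL', hs, h⟩
    by_cases hxj : x j = C.tail e
    · refine ⟨hxj.symm, ?_⟩
      -- after the exchange, the star of `x j` consists of the single edge `e`
      have hnew : ((C.set g (C.tail e) (C.head g) False).set e (C.tail e) (C.head e)
          True).size (x j) = 1 := by
        rw [size, hxj, hV.star.center_set_red, h2, ← Nat.add_zero (#_), ← Nat.add_zero (#_)]
        have := h1 (C.head e)
        rw [if_neg hzw.symm] at this
        rw [if_pos rfl]
        omega
      rw [hnew] at hnimp
      have hpos : 0 < C.size (x j) := by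
        rw [size, ← hgj]; exact inRed_pos hg
      -- so the old star had a single edge, too, and `x j` can be made its centre
      have hone : C.size (x j) = 1 := by omega
      by_contra hlt
      have hlt : C.size (x j) < d := by omega
      have hg1 : #(C.inRed (C.head g)) = 1 := by rw [hgj]; exact hone
      obtain ⟨hVr, hcp, hsz⟩ := hC.swap hd hg hg1
      obtain ⟨hLr, hsr⟩ := hL.transfer hC hVr (fun f => by
        by_cases hfg : f = g
        · subst hfg
          exact .inr ⟨fun _ => ⟨hL.not_reached_of_eq ((hS.center_tail hg).trans hgj),
            hL.not_reached_of_eq ((hS.center_head hg).trans hgj)⟩, fun h => absurd hg h⟩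
        · simp [hfg])
      refine hI ((improvable_of_isolated_of_center hroot hVr hLr (e := e) ?_ ?_ ?_ ?_ ?_ ?_).of_eq
        (by omega) hsr)
      · simpa [hne] using he
      · simp [hne, hxj]
      · rw [hxj, ← hge]; exact hcp
      · intro f hf
        by_cases hfg : f = g
        · subst hfg
          simpa [hne, hge] using ⟨hzw.symm, hwp⟩
        · simp only [ne_eq, hfg, not_false_eq_true, set_red_of_ne, set_tail_of_ne,
            set_head_of_ne, hne] at hf ⊢
          exact hw f hf
      · simpa [hne] using hwx
      · rw [hxj, ← hge, hsz]; omega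
    -- the component of `x j` loses the edge `g`
    · exfalso
      refine hnimp ?_
      have h3 := h1 (C.head g)
      have h4 := h2 (C.head g)
      rw [if_pos rfl] at h3
      rw [if_neg hzw] at h4
      rw [size, size, hS1.center_set_red_of_ne hV.star he1 hxj,
        hS.center_set_blue _ _ (fun _ => by rw [hge]; exact Ne.symm hxj), ← hgj]
      omega
  -- the tail of `e` is a centre
  · rw [hpc] at hej
    by_cases hxj : x j = C.tail e
    · refine ⟨hxj.symm, ?_⟩
      by_contra hlt
      exact hI ((improvable_of_isolated_of_center hroot hC hL he hxj.symm (by rw [← hej, hxj])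
        hw hwx (by omega)).of_eq (by omega) (fun _ _ => rfl))
    -- `x j` is a leaf: replace it in the star by the head of `e`, which leaves `x j` isolated
    · exfalso
      obtain ⟨g, hg, hgx, hgc⟩ | ⟨-, h⟩ := hS.center_cases (x j)
      · have hne : e ≠ g := by rintro rfl; exact he hg
        have hgp : C.head g = C.tail e := by rw [← hgc, hej]
        have hS1 := hS.set_blue g (C.tail e) (x j)
        have he1 : ¬ (C.set g (C.tail e) (x j) False).red e := by simpa [hne] using he
        have h1 := card_inRed_set (C := C) g (C.tail e) (x j) False
        have h2 := card_inRed_set (C := C.set g (C.tail e) (x j) False) e (C.head e)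
          (C.tail e) True
        simp only [he1, hg, false_and, true_and, if_false, add_zero] at h1 h2
        have hV : ((C.set g (C.tail e) (x j) False).set e (C.head e) (C.tail e)
            True).Valid ends c d := by
          refine hC.exchange he hg (by rw [← hC.ends_eq, hgx, hgp, Sym2.eq_swap])
            (by rw [← hC.ends_eq, Sym2.eq_swap]) ?_
          refine hS1.set_red he1 hwp.symm ?_ ?_ ?_
          · intro f hf
            obtain ⟨hfg, hf⟩ := red_of_set_blue hf
            rw [set_tail_of_ne _ _ _ _ hfg, set_head_of_ne _ _ _ _ hfg]
            exact hw f hf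
          · intro f hf
            obtain ⟨hfg, hf⟩ := red_of_set_blue hf
            rw [set_tail_of_ne _ _ _ _ hfg]
            exact hp f hf
          · have := h1 (C.tail e)
            rw [if_pos hgp] at this
            have := hS.card_inRed_le (C.tail e)
            omega
        obtain ⟨hL', hs⟩ := hL.transfer_exchange hC hg hgc.symm (hpc.trans hej) hwr hV
        refine hI ⟨j, by omega, _, hV, hL', hs, ?_⟩
        have h3 := h1 (x j)
        have h4 := h2 (x j)
        have h5 := hS.inRed_tail hg
        rw [hgx] at h5
        have h6 := inRed_pos hg
        rw [if_neg (Ne.symm hxj)] at h4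
        have h7 := hS.center_set_blue_tail (C.tail e) (x j) hg
        rw [hgx] at h7
        rw [size, size, hS1.center_set_red_of_ne hV.star he1 hwj, h7, hgc]
        omega
      · exact hxj (h.symm.trans hej.symm)

end StarColoring

namespace StarColoring

variable {V E : Type*} [Fintype E] {C : StarColoring V E} {d : ℕ}
  {ends : E → Sym2 V} {c : V → ℕ} {x : ℕ → V} {u : V}

/-! ### Greedily minimal colourings -/

/-- The colouring is valid, with a legal order of `n` components starting at `u`, whose sequence
of sizes is lexicographically minimal among all valid colourings with such an order. -/
structure Greedy (ends : E → Sym2 V) (c : V → ℕ) (d : ℕ) (u : V) (C : StarColoring V E)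
    (x : ℕ → V) (n : ℕ) : Prop where
  valid : C.Valid ends c d
  legal : C.Legal x n
  root : x 0 = u
  le : ∀ i < n, ∀ (C' : StarColoring V E) (x' : ℕ → V), C'.Valid ends c d →
    C'.Legal x' (i + 1) → x' 0 = u → (∀ m < i, C'.size (x' m) = C.size (x m)) →
      C.size (x i) ≤ C'.size (x' i)

lemma Greedy.not_improvable {n : ℕ} (h : C.Greedy ends c d u x n) :
    ¬ C.Improvable ends c d x n := by
  rintro ⟨i, hi, C', h1, h2, h3, h4⟩
  exact absurd (h.le i hi C' x h1 h2 h.root h3) (by omega)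

/-- A greedy order of `n` components becomes a greedy order of `n + 1` components once some legal
order with the same sizes can be extended: choose the extension with the smallest new component,
possibly in another colouring. -/
lemma Greedy.succ {n : ℕ} (h : C.Greedy ends c d u x n) {C' : StarColoring V E} {x' : ℕ → V}
    (hC' : C'.Valid ends c d) (hL' : C'.Legal x' (n + 1)) (hx' : x' 0 = u)
    (hs : ∀ m < n, C'.size (x' m) = C.size (x m)) :
    ∃ (D : StarColoring V E) (y : ℕ → V), D.Greedy ends c d u y (n + 1) := by
  have hex : ∃ s, ∃ (D : StarColoring V E) (y : ℕ → V), D.Valid ends c d ∧ D.Legal y (n + 1) ∧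
      y 0 = u ∧ (∀ m < n, D.size (y m) = C.size (x m)) ∧ D.size (y n) = s :=
    ⟨_, C', x', hC', hL', hx', hs, rfl⟩
  obtain ⟨D, y, h1, h2, h3, h4, h5⟩ := Nat.find_spec hex
  refine ⟨D, y, h1, h2, h3, fun i hi D' y' g1 g2 g3 g4 => ?_⟩
  rcases Nat.lt_succ_iff_lt_or_eq.1 hi with hi | rfl
  · rw [h4 i hi]
    exact h.le i hi D' y' g1 g2 g3 fun m hm => (g4 m hm).trans (h4 m (by omega))
  · rw [h5]
    exact Nat.find_min' hex ⟨D', y', g1, g2, g3, fun m hm => (g4 m hm).trans (h4 m hm), rfl⟩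

omit [Fintype E] in
lemma Legal.le_card [Fintype V] {n : ℕ} (h : C.Legal x n) : n ≤ Fintype.card V := by
  have : Set.InjOn (fun i => C.center (x i)) (range n : Finset ℕ) := by
    intro i hi j hj hij
    by_contra hne
    exact h.ne (by simpa using hi) (by simpa using hj) hne hij
  simpa using card_le_card_of_injOn (t := univ) (fun i => C.center (x i)) (by simp) this

lemma Greedy.exists_succ {n : ℕ} (hn : 0 < n) (h : C.Greedy ends c d u x n) {e : E}
    (he : ¬ C.red e) (het : C.Reached x n (C.tail e)) (heh : ¬ C.Reached x n (C.head e)) :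
    ∃ (D : StarColoring V E) (y : ℕ → V), D.Greedy ends c d u y (n + 1) := by
  have hx : ∀ m < n, Function.update x n (C.head e) m = x m := fun m hm => by
    simp [Function.update_of_ne hm.ne]
  have hr : ∀ m ≤ n, ∀ v, C.Reached (Function.update x n (C.head e)) m v ↔ C.Reached x m v := by
    intro m hm v
    refine exists_congr fun i => and_congr_right fun hi => ?_
    rw [hx i (by omega)]
  refine h.succ (x' := Function.update x n (C.head e)) h.valid ⟨?_, ?_⟩ ?_ ?_
  · intro i hi
    rw [hr i (by omega)]
    rcases Nat.lt_succ_iff_lt_or_eq.1 hi with hi | rfl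
    · rw [hx i hi]; exact h.legal.not_reached i hi
    · simpa using heh
  · intro i hi hi0
    rcases Nat.lt_succ_iff_lt_or_eq.1 hi with hi | rfl
    · obtain ⟨f, hf⟩ := h.legal.link i hi hi0
      rw [hx i hi]
      exact ⟨f, hf.1, hf.2.1, (hr i (by omega) _).2 hf.2.2⟩
    · exact ⟨e, he, by simp, (hr i le_rfl _).2 het⟩
  · rw [hx 0 hn, h.root]
  · intro m hm
    rw [hx m hm]

/-- There is a greedy order whose components have a union closed under blue edges: a longest one. -/
lemma exists_maximal_greedy [Fintype V] (u : V) (hC : C.Valid ends c d) :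
    ∃ (C : StarColoring V E) (x : ℕ → V) (n : ℕ), 0 < n ∧ C.Greedy ends c d u x n ∧
      ∀ e, ¬ C.red e → C.Reached x n (C.tail e) → C.Reached x n (C.head e) := by
  by_contra! hcon
  have key : ∀ n, ∃ (C : StarColoring V E) (x : ℕ → V), C.Greedy ends c d u x n := by
    intro n
    induction n with
    | zero =>
      exact ⟨C, fun _ => u, hC, ⟨by simp, by simp⟩, rfl, by simp⟩
    | succ n ih =>
      obtain ⟨D, y, h⟩ := ih
      rcases Nat.eq_zero_or_pos n with rfl | hn
      · refine h.succ (x' := fun _ => u) hC ⟨?_, ?_⟩ rfl (by simp)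
        · rintro i hi ⟨m, hm, -⟩; omega
        · intro i hi hi0; omega
      · obtain ⟨e, he, h1, h2⟩ := hcon D y n hn h
        exact h.exists_succ hn he h1 h2
  obtain ⟨D, y, h⟩ := key (Fintype.card V + 1)
  have := h.legal.le_card
  omega

/-! ### Counting -/

lemma IsStarForest.card_center_eq [Fintype V] (hC : C.IsStarForest d) (v : V) :
    #{w | C.center w = C.center v} = C.size v + 1 := by
  have h1 : ({w | C.center w = C.center v} : Finset V) =
      insert (C.center v) ((C.inRed (C.center v)).image C.tail) := by
    ext w
    simp only [mem_filter, mem_univ, true_and, mem_insert, mem_image, mem_inRed]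
    constructor
    · intro h
      obtain ⟨e, he, hew, h'⟩ | ⟨-, h'⟩ := hC.center_cases w
      · exact .inr ⟨e, ⟨he, h'.symm.trans h⟩, hew⟩
      · exact .inl (h'.symm.trans h)
    · rintro (rfl | ⟨e, ⟨he, heh⟩, rfl⟩)
      · exact hC.center_center v
      · rw [hC.center_tail he, heh]
  rw [h1, card_insert_of_notMem, card_image_of_injOn]
  · rfl
  · intro e he f hf h
    simp only [mem_coe, mem_inRed] at he hf
    exact hC.tail_inj e f he.1 hf.1 h
  · simp only [mem_image, mem_inRed, not_exists, not_and]
    rintro e ⟨he, heh⟩ h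
    exact hC.tail_ne_head e e he he (h.trans heh.symm)

lemma Legal.card_reached [Fintype V] (hC : C.IsStarForest d) {n : ℕ} (hL : C.Legal x n) :
    #{v | C.Reached x n v} = ∑ i ∈ range n, (C.size (x i) + 1) := by
  have h1 : ({v | C.Reached x n v} : Finset V) =
      (range n).biUnion fun i => ({w | C.center w = C.center (x i)} : Finset V) := by
    ext v
    simp only [mem_filter, mem_univ, true_and, mem_biUnion, mem_range]
    rfl
  rw [h1, card_biUnion]
  · exact sum_congr rfl fun i _ => hC.card_center_eq _
  · intro i hi j hj hij
    rw [Function.onFun, Finset.disjoint_left]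
    intro v hv hv'
    simp only [mem_filter, mem_univ, true_and] at hv hv'
    exact hL.ne (by simpa using hi) (by simpa using hj) hij (hv.symm.trans hv')

lemma Legal.card_edges [Fintype V] (hC : C.IsStarForest d) {n : ℕ} (hL : C.Legal x n)
    (hclosed : ∀ e, ¬ C.red e → C.Reached x n (C.tail e) → C.Reached x n (C.head e)) :
    (∑ v with C.Reached x n v, #(C.out v)) + ∑ i ∈ range n, C.size (x i) ≤
      #{e | C.Reached x n (C.tail e) ∧ C.Reached x n (C.head e)} := by
  have hblue : ∑ v with C.Reached x n v, #(C.out v) =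
      #(({v | C.Reached x n v} : Finset V).biUnion C.out) := by
    rw [card_biUnion]
    intro v _ w _ hvw
    rw [Function.onFun, Finset.disjoint_left]
    intro e he he'
    rw [mem_out] at he he'
    exact hvw (he.2.symm.trans he'.2)
  have hred : ∑ i ∈ range n, C.size (x i) =
      #((range n).biUnion fun i => C.inRed (C.center (x i))) := by
    rw [card_biUnion]
    · rfl
    · intro i hi j hj hij
      rw [Function.onFun, Finset.disjoint_left]
      intro e he he'
      rw [mem_inRed] at he he'
      exact hL.ne (by simpa using hi) (by simpa using hj) hij (he.2.symm.trans he'.2)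
  rw [hblue, hred, ← card_union_of_disjoint]
  · refine card_le_card fun e he => ?_
    simp only [mem_union, mem_biUnion, mem_filter, mem_univ, true_and, mem_out, mem_inRed,
      mem_range] at he ⊢
    rcases he with ⟨v, hv, he, rfl⟩ | ⟨i, hi, he, hei⟩
    · exact ⟨hv, hclosed e he hv⟩
    · exact ⟨⟨i, hi, by rw [hC.center_tail he, hei]⟩, ⟨i, hi, by rw [hC.center_head he, hei]⟩⟩
  · rw [Finset.disjoint_left]
    intro e he he'
    simp only [mem_biUnion, mem_out, mem_inRed] at he he'
    obtain ⟨_, _, he, _⟩ := he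
    obtain ⟨_, _, he', _⟩ := he'
    exact he he'

omit [Fintype E] in
lemma Legal.injOn {n : ℕ} (hL : C.Legal x n) : Set.InjOn x (range n : Finset ℕ) := by
  intro i hi j hj hij
  by_contra hne
  exact hL.ne (by simpa using hi) (by simpa using hj) hne (by rw [hij])

/-- The isolated components after the first inject into the blue edges leaving entry vertices of
components with `d` edges. -/
lemma Legal.card_isolated_le (hC : C.Valid ends c d) {n : ℕ} (hL : C.Legal x n)
    (hiso : ∀ l < n, 0 < l → C.size (x l) = 0 →
      ∃ e, ¬ C.red e ∧ C.head e = x l ∧ ∃ j < n, C.tail e = x j ∧ C.size (x j) = d) :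
    #{l ∈ range n | 0 < l ∧ C.size (x l) = 0} ≤
      ∑ j ∈ range n with C.size (x j) = d, c (x j) := by
  calc #{l ∈ range n | 0 < l ∧ C.size (x l) = 0}
      = #(({l ∈ range n | 0 < l ∧ C.size (x l) = 0} : Finset ℕ).image x) := by
        rw [card_image_of_injOn]
        exact hL.injOn.mono (by simp +contextual [Set.subset_def])
    _ ≤ #((({j ∈ range n | C.size (x j) = d} : Finset ℕ).biUnion
          fun j => C.out (x j)).image C.head) := by
        refine card_le_card fun w hw => ?_
        simp only [mem_image, mem_filter, mem_range, mem_biUnion, mem_out] at hw ⊢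
        obtain ⟨l, ⟨hl, hl0, hls⟩, rfl⟩ := hw
        obtain ⟨e, he, heh, j, hj, hej, hjs⟩ := hiso l hl hl0 hls
        exact ⟨e, ⟨j, ⟨hj, hjs⟩, he, hej⟩, heh⟩
    _ ≤ ∑ j ∈ range n with C.size (x j) = d, #(C.out (x j)) := card_image_le.trans card_biUnion_le
    _ ≤ ∑ j ∈ range n with C.size (x j) = d, c (x j) := sum_le_sum fun j _ => hC.out_le _

omit [Fintype E] in
lemma Legal.sum_excess_le [Fintype V] {k n : ℕ} (hL : C.Legal x n) :
    ∑ i ∈ range n, (c (x i) - k) ≤ ∑ v with C.Reached x n v, (c v - k) := by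
  rw [← sum_image (f := fun v => c v - k) hL.injOn]
  refine sum_le_sum_of_subset fun v hv => ?_
  simp only [mem_image, mem_range, mem_filter, mem_univ, true_and] at hv ⊢
  obtain ⟨i, hi, rfl⟩ := hv
  exact ⟨i, hi, rfl⟩

/-- The discharging inequality. A component with `d` edges pays for itself and for the at most
`c (x j)` isolated components entered from it; any other nontrivial component pays
for itself because each edge contributes `k + 1 ≥ d`; and if the first component is
isolated, the excess capacity of `x 0` pays for it. -/
lemma Legal.mul_le_sum {k n : ℕ} (hdk : d ≤ k + 1) (hc : ∀ v, k ≤ c v) (hroot : k < c (x 0))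
    (hC : C.Valid ends c d) (hL : C.Legal x n)
    (hiso : 0 < d → ∀ l < n, 0 < l → C.size (x l) = 0 →
      ∃ e, ¬ C.red e ∧ C.head e = x l ∧ ∃ j < n, C.tail e = x j ∧ C.size (x j) = d) :
    d * n ≤ (k + 1) * ∑ i ∈ range n, C.size (x i) + d * ∑ i ∈ range n, (c (x i) - k) := by
  rcases Nat.eq_zero_or_pos d with rfl | hd
  · simp
  have h1 := hL.card_isolated_le hC (hiso hd)
  have h2 : n ≤ #{l ∈ range n | 0 < l ∧ C.size (x l) = 0} +
      ∑ j ∈ range n, (if 0 < j ∧ C.size (x j) = 0 then 0 else 1) := by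
    rw [card_filter, ← sum_add_distrib]
    calc n = ∑ j ∈ range n, 1 := by simp
      _ ≤ _ := sum_le_sum fun j _ => by split_ifs <;> simp
  rw [sum_filter] at h1
  have h3 : d * n ≤ d * ((∑ j ∈ range n, if C.size (x j) = d then c (x j) else 0) +
      ∑ j ∈ range n, (if 0 < j ∧ C.size (x j) = 0 then 0 else 1)) :=
    Nat.mul_le_mul_left _ (by omega)
  refine h3.trans ?_
  rw [← sum_add_distrib, mul_sum, mul_sum, mul_sum, ← sum_add_distrib]
  refine sum_le_sum fun j _ => ?_
  obtain ⟨a, ha⟩ := Nat.exists_eq_add_of_le (hc (x j))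
  rw [ha, Nat.add_sub_cancel_left]
  by_cases hs : C.size (x j) = 0
  · rw [hs, if_neg (by omega)]
    by_cases hj : j = 0
    · subst hj
      have : 1 ≤ a := by omega
      simp only [lt_irrefl, false_and, if_false]
      nlinarith
    · simp [Nat.pos_of_ne_zero hj]
  · simp only [hs, and_false, if_false]
    by_cases hsd : C.size (x j) = d
    · rw [if_pos hsd, hsd]
      apply le_of_eq; ring
    · rw [if_neg hsd]
      have : 1 ≤ C.size (x j) := by omega
      nlinarith

/-- If the capacity of `u` exceeds `k` and cannot be lowered, the vertex set of a maximal greedy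
order starting at `u` spans too many edges. -/
lemma Greedy.false_of_density [Fintype V] {k n : ℕ} (hn : 0 < n) (hdk : d ≤ k + 1)
    (hc : ∀ v, k ≤ c v) (hu : k < c u)
    (hroot : ∀ C : StarColoring V E, C.Valid ends c d → c u ≤ #(C.out u))
    (hdens : ∀ H : Finset V, H.Nonempty →
      (d + k + 1) * #{e | ∀ v ∈ ends e, v ∈ H} ≤ (k * (d + k + 1) + d) * #H)
    (hG : C.Greedy ends c d u x n)
    (hclosed : ∀ e, ¬ C.red e → C.Reached x n (C.tail e) → C.Reached x n (C.head e)) : False := by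
  obtain rfl := hG.root
  have hL := hG.legal
  have hS := hG.valid.star
  have hI := hG.not_improvable
  have hIm : ∀ m < n, ¬ C.Improvable ends c d x (m + 1) :=
    fun m hm h => hI (h.of_eq (by omega) fun _ _ => rfl)
  have hfull : ∀ v, C.Reached x n v → c v ≤ #(C.out v) := by
    rintro v ⟨m, hm, hv⟩
    by_contra! hlt
    exact hIm m hm (improvable_of_deficient hroot m C hG.valid (hL.mono (by omega)) v hv hlt)
  have hiso : 0 < d → ∀ l < n, 0 < l → C.size (x l) = 0 →
      ∃ e, ¬ C.red e ∧ C.head e = x l ∧ ∃ j < n, C.tail e = x j ∧ C.size (x j) = d := by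
    intro hd l hl hl0 hls
    obtain ⟨e, he, hel, j, hj, hej⟩ := hL.link l hl hl0
    have hw := (hS.of_size_eq_zero hls).2
    rw [← hel] at hw
    refine ⟨e, he, hel, j, by omega, eq_and_size_eq_of_not_improvable hroot hG.valid
      (hL.mono (by omega)) hd he hej hw (fun m hm h => ?_) (hIm j (by omega))⟩
    exact hL.ne (by omega : m < n) hl (by omega) (by rw [h, hel])
  have h1 := hL.mul_le_sum hdk hc hu hG.valid hiso
  have h2 := hL.sum_excess_le (c := c) (k := k)
  have h3 := hL.card_edges hS hclosed
  have h4 := hL.card_reached hS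
  have h5 := hdens {v | C.Reached x n v} ⟨x 0, by simpa using ⟨0, hn, rfl⟩⟩
  have h6 : ({e | ∀ v ∈ ends e, v ∈ ({v | C.Reached x n v} : Finset V)} : Finset E) =
      ({e | C.Reached x n (C.tail e) ∧ C.Reached x n (C.head e)} : Finset E) := by
    ext e
    simp [← hG.valid.ends_eq e]
  rw [h6] at h5
  have h7 : k * #{v | C.Reached x n v} + ∑ v with C.Reached x n v, (c v - k) ≤
      ∑ v with C.Reached x n v, #(C.out v) := by
    rw [mul_comm, ← smul_eq_mul, ← sum_const, ← sum_add_distrib]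
    refine sum_le_sum fun v hv => ?_
    have := hfull v (by simpa using hv)
    have := hc v
    omega
  have h8 : 1 ≤ ∑ i ∈ range n, (c (x i) - k) :=
    (by omega : 1 ≤ c (x 0) - k).trans
      (single_le_sum (f := fun i => c (x i) - k) (fun _ _ => Nat.zero_le _) (mem_range.2 hn))
  rw [sum_add_distrib] at h4
  simp only [sum_const, card_range, smul_eq_mul, mul_one] at h4
  generalize #({e | C.Reached x n (C.tail e) ∧ C.Reached x n (C.head e)} : Finset E) = m at *
  generalize #({v | C.Reached x n v} : Finset V) = N at *
  generalize ∑ v with C.Reached x n v, (c v - k) = X at *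
  generalize ∑ i ∈ range n, (c (x i) - k) = Y at *
  generalize ∑ i ∈ range n, C.size (x i) = S at *
  have h10 : (d + k + 1) * (k * N + X + S) ≤ (d + k + 1) * m := Nat.mul_le_mul_left _ (by omega)
  subst h4
  have h11 : d * Y ≤ d * X := Nat.mul_le_mul_left _ h2
  nlinarith

/-- Under the density condition, the edges can be coloured and oriented such that red stars have at
most `d` edges and blue outdegrees are at most `k`. -/
theorem exists_valid [Fintype V] {k : ℕ} (hdk : d ≤ k + 1) (a : E → V × V)
    (hdens : ∀ H : Finset V, H.Nonempty →
      (d + k + 1) * #{e | (a e).1 ∈ H ∧ (a e).2 ∈ H} ≤ (k * (d + k + 1) + d) * #H) :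
    ∃ C : StarColoring V E, C.Valid (fun e => s((a e).1, (a e).2)) (fun _ => k) d := by
  have hdens' : ∀ H : Finset V, H.Nonempty →
      (d + k + 1) * #{e | ∀ v ∈ s((a e).1, (a e).2), v ∈ H} ≤ (k * (d + k + 1) + d) * #H := by
    intro H hH
    simpa using hdens H hH
  -- choose capacities of minimal sum; if one exceeds `k`, it is attained in every valid colouring
  have hex : ∃ t, ∃ c : V → ℕ, (∀ v, k ≤ c v) ∧
      (∃ C : StarColoring V E, C.Valid (fun e => s((a e).1, (a e).2)) c d) ∧ ∑ v, c v = t := by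
    refine ⟨_, fun _ => k + Fintype.card E, fun _ => Nat.le_add_right _ _,
      ⟨⟨fun e => (a e).1, fun e => (a e).2, fun _ => False⟩, fun _ => rfl, ⟨?_, ?_, ?_⟩, ?_⟩, rfl⟩
    · simp
    · simp
    · simp
    · exact fun v => (card_le_univ _).trans (Nat.le_add_left _ _)
  obtain ⟨c, hc, ⟨C, hC⟩, hsum⟩ := Nat.find_spec hex
  by_cases hck : ∀ v, c v ≤ k
  · exact ⟨C, hC.ends_eq, hC.star, fun v => (hC.out_le v).trans (hck v)⟩
  push Not at hck
  obtain ⟨u, hu⟩ := hck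
  exfalso
  obtain ⟨D, x, n, hn, hG, hcl⟩ := exists_maximal_greedy u hC
  refine hG.false_of_density hn hdk hc hu (fun C hC => ?_) hdens' hcl
  by_contra! hlt
  refine Nat.find_min hex (m := ∑ v, Function.update c u (c u - 1) v) ?_
    ⟨Function.update c u (c u - 1), fun v => ?_, ⟨C, hC.ends_eq, hC.star, fun v => ?_⟩, rfl⟩
  · rw [← hsum]
    refine sum_lt_sum (fun v _ => ?_) ⟨u, mem_univ _, ?_⟩
    · by_cases hv : v = u
      · subst hv; simp
      · simp [hv]
    · simp; omega
  · by_cases hv : v = u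
    · subst hv; simp; omega
    · simp [hv, hc v]
  · by_cases hv : v = u
    · subst hv; simp; omega
    · simpa [hv] using hC.out_le v

end StarColoring
end

namespace Graph

open Set

variable {α β : Type*} {F C C' K : Graph α β} {t h : β → α}

/-! ### Orientations with outdegree at most one

Throughout, `t e` and `h e` are the tail and the head of the edge `e`, and `t` is injective on the
edges, that is, all outdegrees are at most one. -/

open scoped Fin.CommRing in
lemma fin_forall_of_succ {n : ℕ} {P : Fin (n + 1) → Prop} {i : Fin (n + 1)} (hi : P i)
    (hP : ∀ j, P j → P (j + 1)) (j : Fin (n + 1)) : P j := by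
  have key : ∀ m : ℕ, P (i + (m : Fin (n + 1))) := by
    intro m
    induction m with
    | zero => simpa using hi
    | succ m ih =>
      have := hP _ ih
      rwa [add_assoc, ← Nat.cast_succ] at this
  have := key (j - i).val
  rwa [Fin.cast_val_eq_self, add_sub_cancel] at this

lemma fin_forall_of_pred {n : ℕ} {P : Fin (n + 1) → Prop} {i : Fin (n + 1)} (hi : P i)
    (hP : ∀ j, P (j + 1) → P j) (j : Fin (n + 1)) : P j := by
  by_contra hj
  exact fin_forall_of_succ (P := fun j => ¬ P j) hj (fun j hj h => hj (hP j h)) i hi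

/-- A cycle is oriented consistently. Hence each of its vertices is the tail of one of its edges,
and it lies inside every set that it meets and that is closed under outgoing edges. -/
lemma IsCycle.exists_tail_eq_and_subset (hC : C.IsCycle) (hCF : C ≤ F)
    (hth : ∀ e ∈ E(F), F.IsLink e (t e) (h e)) (hinj : InjOn t E(F)) :
    (∀ v ∈ V(C), ∃ e ∈ E(C), t e = v) ∧
      ∀ S : Set α, (∀ e ∈ E(F), t e ∈ S → h e ∈ S) → (V(C) ∩ S).Nonempty → V(C) ⊆ S := by
  obtain ⟨n, v, e, hv, he, hVC, hEC, hlink⟩ := hC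
  have heF : ∀ i, e i ∈ E(F) := fun i => ((hlink i).mono hCF).edge_mem
  have hends : ∀ i, (t (e i) = v i ∧ h (e i) = v (i + 1)) ∨
      (t (e i) = v (i + 1) ∧ h (e i) = v i) := fun i =>
    (hth _ (heF i)).eq_and_eq_or_eq_and_eq ((hlink i).mono hCF)
  rw [hVC, hEC]
  by_cases hfwd : ∀ i, t (e i) = v i ∧ h (e i) = v (i + 1)
  · refine ⟨?_, ?_⟩
    · rintro _ ⟨i, rfl⟩
      exact ⟨_, ⟨i, rfl⟩, (hfwd i).1⟩
    · rintro S hS ⟨_, ⟨i, rfl⟩, hi⟩ _ ⟨j, rfl⟩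
      refine fin_forall_of_succ (P := fun j => v j ∈ S) hi (fun j hj => ?_) j
      rw [← (hfwd j).2]
      exact hS _ (heF j) (by rwa [(hfwd j).1])
  · push Not at hfwd
    obtain ⟨i, hi⟩ := hfwd
    have hi' : t (e i) = v (i + 1) ∧ h (e i) = v i :=
      (hends i).resolve_left fun h' => hi h'.1 h'.2
    -- an edge directed backwards forces the next one to be directed backwards
    have hbwd : ∀ j, t (e j) = v (j + 1) ∧ h (e j) = v j := by
      refine fin_forall_of_succ hi' fun j hj => ?_
      rcases hends (j + 1) with h' | h'
      · have : j + 1 = j := he (hinj (heF _) (heF _) (h'.1.trans hj.1.symm))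
        rwa [this]
      · exact h'
    refine ⟨?_, ?_⟩
    · rintro _ ⟨i, rfl⟩
      exact ⟨_, ⟨i - 1, rfl⟩, by rw [(hbwd _).1, sub_add_cancel]⟩
    · rintro S hS ⟨_, ⟨i, rfl⟩, hi⟩ _ ⟨j, rfl⟩
      refine fin_forall_of_pred (P := fun j => v j ∈ S) hi (fun j hj => ?_) j
      rw [← (hbwd j).2]
      exact hS _ (heF j) (by rwa [(hbwd j).1])

lemma IsCycle.head_mem (hC : C.IsCycle) (hCF : C ≤ F)
    (hth : ∀ e ∈ E(F), F.IsLink e (t e) (h e)) (hinj : InjOn t E(F)) {e : β} (he : e ∈ E(F))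
    (htC : t e ∈ V(C)) : h e ∈ V(C) := by
  obtain ⟨f, hf, hfe⟩ := (hC.exists_tail_eq_and_subset hCF hth hinj).1 _ htC
  obtain rfl := hinj (hCF.edgeSet_mono hf) he hfe
  exact ((hCF.isLink_iff hf).2 (hth _ he)).right_mem

/-- Since outdegrees are at most one, having a common descendant is an equivalence relation on the
vertices. -/
lemma IsConnected.exists_common_descendant (hK : K.IsConnected) (hKF : K ≤ F)
    (hth : ∀ e ∈ E(F), F.IsLink e (t e) (h e)) (hinj : InjOn t E(F)) {x y : α}
    (hx : x ∈ V(K)) (hy : y ∈ V(K)) :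
    ∃ z, Relation.ReflTransGen (fun a b => ∃ e ∈ E(F), t e = a ∧ h e = b) x z ∧
      Relation.ReflTransGen (fun a b => ∃ e ∈ E(F), t e = a ∧ h e = b) y z := by
  induction hK.2 x hx y hy with
  | refl => exact ⟨x, .refl, .refl⟩
  | @tail b c _ hbc ih =>
    obtain ⟨z, hxz, hbz⟩ := ih hbc.left_mem
    obtain ⟨e, he⟩ := hbc
    have he := he.mono hKF
    rcases (hth e he.edge_mem).eq_and_eq_or_eq_and_eq he with ⟨h1, h2⟩ | ⟨h1, h2⟩
    · rcases hbz.cases_head with rfl | ⟨w, ⟨f, hf, hfb, rfl⟩, hwz⟩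
      · exact ⟨c, hxz.tail ⟨e, he.edge_mem, h1, h2⟩, .refl⟩
      · obtain rfl := hinj hf he.edge_mem (hfb.trans h1.symm)
        exact ⟨z, hxz, h2 ▸ hwz⟩
    · exact ⟨z, hxz, .head ⟨e, he.edge_mem, h1, h2⟩ hbz⟩

/-- Two cycles in a component have a common vertex, as both are closed under outgoing edges.
Therefore each contains the other. -/
lemma isPseudoforest_of_injOn (hth : ∀ e ∈ E(F), F.IsLink e (t e) (h e))
    (hinj : InjOn t E(F)) : F.IsPseudoforest := by
  intro K hK C C' hCK hCK' hC hC'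
  have hKF : K ≤ F := hK.1.1
  have hCF := hCK.trans hKF
  have hCF' := hCK'.trans hKF
  have hne : ∀ {D : Graph α β}, D.IsCycle → V(D).Nonempty := by
    rintro D ⟨n, v, e, -, -, hV, -⟩
    exact hV ▸ range_nonempty v
  obtain ⟨x, hx⟩ := hne hC
  obtain ⟨y, hy⟩ := hne hC'
  obtain ⟨z, hxz, hyz⟩ := hK.1.2.exists_common_descendant hKF hth hinj
    (hCK.vertexSet_mono hx) (hCK'.vertexSet_mono hy)
  have hclosed : ∀ {D : Graph α β}, D.IsCycle → D ≤ F → ∀ {a b},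
      Relation.ReflTransGen (fun a b => ∃ e ∈ E(F), t e = a ∧ h e = b) a b → a ∈ V(D) →
        b ∈ V(D) := by
    intro D hD hDF a b hab ha
    induction hab with
    | refl => exact ha
    | tail _ hbc ih =>
      obtain ⟨e, he, rfl, rfl⟩ := hbc
      exact hD.head_mem hDF hth hinj he ih
  have hz := hclosed hC hCF hxz hx
  have hz' := hclosed hC' hCF' hyz hy
  have hV : V(C) = V(C') := subset_antisymm
    ((hC.exists_tail_eq_and_subset hCF hth hinj).2 _
      (fun e he => hC'.head_mem hCF' hth hinj he) ⟨z, hz, hz'⟩)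
    ((hC'.exists_tail_eq_and_subset hCF' hth hinj).2 _
      (fun e he => hC.head_mem hCF hth hinj he) ⟨z, hz', hz⟩)
  have hE : ∀ {D D' : Graph α β}, D.IsCycle → D'.IsCycle → D ≤ F → D' ≤ F → V(D) = V(D') →
      E(D) ⊆ E(D') := by
    intro D D' hD hD' hDF hDF' hV e he
    have heF := hDF.edgeSet_mono he
    have hte : t e ∈ V(D') := hV ▸ ((hDF.isLink_iff he).2 (hth _ heF)).left_mem
    obtain ⟨f, hf, hfe⟩ := (hD'.exists_tail_eq_and_subset hDF' hth hinj).1 _ hte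
    obtain rfl := hinj (hDF'.edgeSet_mono hf) heF hfe
    exact hf
  exact Compatible.ext hV
    (subset_antisymm (hE hC hC' hCF hCF' hV) (hE hC' hC hCF' hCF hV.symm))
    (Compatible.of_le_le hCF hCF')

/-- On a consistently oriented cycle, every head is a tail. -/
lemma isForest_of_tail_ne_head (hth : ∀ e ∈ E(F), F.IsLink e (t e) (h e)) (hinj : InjOn t E(F))
    (hne : ∀ e ∈ E(F), ∀ f ∈ E(F), t e ≠ h f) : F.IsForest := by
  intro C hCF hC
  obtain ⟨e, he⟩ : E(C).Nonempty := by
    obtain ⟨n, v, e, -, -, -, hE, -⟩ := hC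
    exact hE ▸ range_nonempty e
  have heF := hCF.edgeSet_mono he
  have hhe := ((hCF.isLink_iff he).2 (hth _ heF)).right_mem
  obtain ⟨f, hf, hfe⟩ := (hC.exists_tail_eq_and_subset hCF hth hinj).1 _ hhe
  exact hne f (hCF.edgeSet_mono hf) e heF hfe

/-- If no head is a tail, every component consists of a vertex `c` and the edges with head `c`. -/
lemma IsComponent.exists_center (hth : ∀ e ∈ E(F), F.IsLink e (t e) (h e))
    (hinj : InjOn t E(F)) (hne : ∀ e ∈ E(F), ∀ f ∈ E(F), t e ≠ h f) (hK : F.IsComponent K) :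
    ∃ c, V(K) = insert c (t '' {e ∈ E(F) | h e = c}) ∧ E(K) = {e ∈ E(F) | h e = c} := by
  obtain ⟨⟨hKF, ⟨z, hz⟩, hconn⟩, hmax⟩ := hK
  obtain ⟨c, hcF, hct, hzc⟩ : ∃ c ∈ V(F), (∀ e ∈ E(F), t e ≠ c) ∧
      (z = c ∨ ∃ e ∈ E(F), h e = c ∧ t e = z) := by
    by_cases hex : ∃ e ∈ E(F), t e = z
    · obtain ⟨e, he, hez⟩ := hex
      exact ⟨h e, (hth e he).right_mem, fun f hf => hne f hf e he, .inr ⟨e, he, rfl, hez⟩⟩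
    · exact ⟨z, hKF.vertexSet_mono hz, fun e he hez => hex ⟨e, he, hez⟩, .inl rfl⟩
  set X : Set α := insert c (t '' {e ∈ E(F) | h e = c}) with hX
  have hXF : X ⊆ V(F) := by
    rintro x (rfl | ⟨e, ⟨he, -⟩, rfl⟩)
    · exact hcF
    · exact (hth e he).left_mem
  have hzX : z ∈ X := by
    rcases hzc with rfl | ⟨e, he, hec, hez⟩
    · exact .inl rfl
    · exact .inr ⟨e, ⟨he, hec⟩, hez⟩
  have hadj : ∀ x ∈ X, ∀ y, F.Adj x y → y ∈ X := by
    rintro x hx y ⟨e, he⟩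
    have heF := he.edge_mem
    rcases (hth e heF).eq_and_eq_or_eq_and_eq he with ⟨rfl, rfl⟩ | ⟨rfl, rfl⟩
    · rcases hx with hx | ⟨f, ⟨hf, hfc⟩, hfe⟩
      · exact absurd hx (hct e heF)
      · obtain rfl := hinj hf heF hfe
        exact .inl hfc
    · rcases hx with hx | ⟨f, ⟨hf, hfc⟩, hfe⟩
      · exact .inr ⟨e, ⟨heF, hx⟩, rfl⟩
      · exact absurd hfe (hne f hf e heF)
  have hKX : V(K) ⊆ X := by
    intro y hy
    induction hconn z hz y hy with
    | refl => exact hzX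
    | tail _ hbc ih => exact hadj _ (ih hbc.left_mem) _ (hbc.mono hKF)
  have hle : K ≤ F.induce X :=
    ⟨hKX, fun e x y hexy => ⟨hexy.mono hKF, hKX hexy.left_mem, hKX hexy.right_mem⟩⟩
  have hstar : ∀ x ∈ X, Relation.ReflTransGen (F.induce X).Adj x c ∧
      Relation.ReflTransGen (F.induce X).Adj c x := by
    rintro x (rfl | ⟨e, ⟨he, hec⟩, rfl⟩)
    · exact ⟨.refl, .refl⟩
    · have hl : (F.induce X).IsLink e (t e) c :=
        ⟨hec ▸ hth e he, .inr ⟨e, ⟨he, hec⟩, rfl⟩, .inl rfl⟩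
      exact ⟨.single hl.adj, .single hl.symm.adj⟩
  have hKeq : K = F.induce X := le_antisymm hle (hmax ⟨induce_le hXF, ⟨c, .inl rfl⟩,
    fun x hx y hy => (hstar x hx).1.trans (hstar y hy).2⟩ hle)
  refine ⟨c, by rw [hKeq]; rfl, ?_⟩
  ext e
  rw [hKeq, edgeSet_induce]
  constructor
  · rintro ⟨x, y, he, hx, hy⟩
    have heF := he.edge_mem
    refine ⟨heF, ?_⟩
    have hteX : t e ∈ X := by
      rcases (hth e heF).eq_and_eq_or_eq_and_eq he with ⟨h1, -⟩ | ⟨h1, -⟩ <;> rwa [h1]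
    rcases hteX with h1 | ⟨f, ⟨hf, hfc⟩, hfe⟩
    · exact absurd h1 (hct e heF)
    · obtain rfl := hinj hf heF hfe
      exact hfc
  · rintro ⟨he, hec⟩
    exact ⟨t e, h e, hth e he, .inr ⟨e, ⟨he, hec⟩, rfl⟩, .inl hec⟩

lemma IsComponent.isStar (hfin : E(F).Finite) (hth : ∀ e ∈ E(F), F.IsLink e (t e) (h e))
    (hinj : InjOn t E(F)) (hne : ∀ e ∈ E(F), ∀ f ∈ E(F), t e ≠ h f) (hK : F.IsComponent K) :
    K.IsStar := by
  obtain ⟨c, hV, hE⟩ := hK.exists_center hth hinj hne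
  have hKF : K ≤ F := hK.1.1
  have hEF : ∀ e ∈ E(K), e ∈ E(F) ∧ h e = c := fun e he => by rwa [hE] at he
  have : Finite E(K) := (hfin.subset hKF.edgeSet_mono).to_subtype
  let φ := (Finite.equivFin E(K)).symm
  refine ⟨_, c, fun i => t (φ i), fun i => φ i, ?_, ?_, ?_, ?_, ?_, ?_⟩
  · intro i j hij
    exact φ.injective (Subtype.ext (hinj (hEF _ (φ i).2).1 (hEF _ (φ j).2).1 hij))
  · intro i
    have := hEF _ (φ i).2
    rw [← this.2]
    exact hne _ this.1 _ this.1
  · exact Subtype.val_injective.comp φ.injective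
  · rw [hV, ← hE]
    congr 1
    ext x
    constructor
    · rintro ⟨e, he, rfl⟩
      exact ⟨φ.symm ⟨e, he⟩, congrArg (fun f => t f.1) (φ.apply_symm_apply ⟨e, he⟩)⟩
    · rintro ⟨i, rfl⟩
      exact ⟨_, (φ i).2, rfl⟩
  · ext e
    constructor
    · intro he
      exact ⟨φ.symm ⟨e, he⟩, congrArg Subtype.val (φ.apply_symm_apply ⟨e, he⟩)⟩
    · rintro ⟨i, rfl⟩
      exact (φ i).2
  · intro i
    have := hEF _ (φ i).2
    rw [hKF.isLink_iff (φ i).2]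
    exact (this.2 ▸ hth _ this.1).symm

/-! ### The decomposition -/

lemma mul_card_edges_le_of_mad_le {G : Graph α β} {k d : ℕ} (hV : V(G).Finite) (hE : E(G).Finite)
    (hmad : G.mad ≤ 2 * ((k : ℝ) + (d : ℝ) / ((d : ℝ) + (k : ℝ) + 1))) {X : Set α} (hX : X ⊆ V(G))
    (hne : X.Nonempty) :
    (d + k + 1) * E(G.induce X).ncard ≤ (k * (d + k + 1) + d) * X.ncard := by
  have h1 : 2 * (E(G.induce X).ncard : ℝ) / (X.ncard : ℝ) ≤ G.mad :=
    (isGreatest_mad G hV hE (hne.mono hX)).2 ⟨G.induce X, induce_le hX, hne, rfl⟩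
  have hpos : (0 : ℝ) < X.ncard := by
    exact_mod_cast (ncard_pos (hV.subset hX)).2 hne
  have hpos' : (0 : ℝ) < (d : ℝ) + k + 1 := by positivity
  have h2 := h1.trans hmad
  rw [div_le_iff₀ hpos] at h2
  have h3 : ((d : ℝ) + k + 1) * (E(G.induce X).ncard : ℝ) ≤
      ((k : ℝ) * (d + k + 1) + d) * (X.ncard : ℝ) := by
    have h4 := mul_le_mul_of_nonneg_left h2 hpos'.le
    have h5 : ((d : ℝ) + k + 1) * (2 * ((k : ℝ) + (d : ℝ) / ((d : ℝ) + (k : ℝ) + 1)) * X.ncard) =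
        2 * (((k : ℝ) * (d + k + 1) + d) * (X.ncard : ℝ)) := by
      field_simp
    linarith
  exact_mod_cast h3

end Graph

namespace StarColoring

open Finset

open scoped Classical in
/-- Distribute the blue edges over `k` classes, and put the red edges into the last one, such that
every class has outdegrees at most one. -/
lemma Valid.exists_coloring {V E : Type*} [Fintype E] {C : StarColoring V E} {ends : E → Sym2 V}
    {k d : ℕ} (hC : C.Valid ends (fun _ => k) d) :
    ∃ col : E → Fin (k + 1), (∀ e, col e = Fin.last k ↔ C.red e) ∧
      ∀ e f, col e = col f → C.tail e = C.tail f → e = f := by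
  have hg : ∀ v, ∃ g : E → Fin (k + 1), Set.InjOn g (C.out v) ∧
      ∀ e ∈ C.out v, g e ≠ Fin.last k := by
    intro v
    obtain ⟨φ⟩ : Nonempty (C.out v ↪ Fin k) :=
      Function.Embedding.nonempty_of_card_le
        (by rw [Fintype.card_coe, Fintype.card_fin]; exact hC.out_le v)
    refine ⟨fun e => if h : e ∈ C.out v then (φ ⟨e, h⟩).castSucc else 0, ?_, ?_⟩
    · intro e he f hf hef
      rw [mem_coe] at he hf
      simp only [he, hf, dif_pos] at hef
      simpa using φ.injective (Fin.castSucc_injective _ hef)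
    · intro e he
      simp only [he, dif_pos]
      exact (Fin.castSucc_lt_last _).ne
  choose g hinj hlast using hg
  have hblue : ∀ e, ¬ C.red e → g (C.tail e) e ≠ Fin.last k := fun e he =>
    hlast _ e (by simp [he])
  refine ⟨fun e => if C.red e then Fin.last k else g (C.tail e) e, fun e => ?_, fun e f => ?_⟩
  · by_cases he : C.red e <;> simp [he, hblue]
  · by_cases he : C.red e <;> by_cases hf : C.red f <;> simp only [he, hf, if_true, if_false]
    · exact fun _ h => hC.star.tail_inj e f he hf h
    · exact fun h => absurd h.symm (hblue f hf)
    · exact fun h => absurd h (hblue e he)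
    · intro h ht
      exact hinj (C.tail e) (by simp [he]) (by simp [hf, ht]) (by rw [h, ht])

end StarColoring

open Graph in
theorem corollary1p10 {α β : Type*} (k d : ℕ) (hdk : d ≤ k + 1) (G : Graph α β)
    (hV : G.vertexSet.Finite) (hE : G.edgeSet.Finite)
    (hmad : G.mad ≤ 2 * ((k : ℝ) + (d : ℝ) / ((d : ℝ) + (k : ℝ) + 1))) :
    ∃ F : Fin (k + 1) → Graph α β,
      G.IsDecomposition F ∧ (∀ i, (F i).IsPseudoforest) ∧
      ∃ i, (F i).IsForest ∧
        ∀ K : Graph α β, (F i).IsComponent K → K.edgeSet.ncard ≤ d ∧ K.IsStar := by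
  classical
  have := hV.fintype
  have := hE.fintype
  have hlink : ∀ e : E(G), ∃ p : V(G) × V(G), G.IsLink e p.1 p.2 := by
    rintro ⟨e, he⟩
    obtain ⟨x, y, hxy⟩ := exists_isLink_of_mem_edgeSet he
    exact ⟨⟨⟨x, hxy.left_mem⟩, ⟨y, hxy.right_mem⟩⟩, hxy⟩
  choose a ha using hlink
  obtain ⟨C, hC⟩ := StarColoring.exists_valid (d := d) hdk a fun H hH => by
    have h1 := mul_card_edges_le_of_mad_le hV hE hmad (X := Subtype.val '' (H : Set V(G)))
      (by rintro _ ⟨v, -, rfl⟩; exact v.2) (by simpa using hH)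
    rw [Set.ncard_image_of_injective _ Subtype.val_injective, Set.ncard_coe_finset] at h1
    refine le_trans (Nat.mul_le_mul_left _ ?_) h1
    rw [← Set.ncard_coe_finset, ← Set.ncard_image_of_injective _ Subtype.val_injective]
    refine Set.ncard_le_ncard ?_ (hE.subset ?_)
    · rintro _ ⟨e, he, rfl⟩
      simp only [Finset.coe_filter, Finset.mem_univ, true_and, Set.mem_ofPred_eq] at he
      rw [edgeSet_induce]
      exact ⟨_, _, ha e, ⟨_, he.1, rfl⟩, ⟨_, he.2, rfl⟩⟩
    · rw [edgeSet_induce]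
      rintro e ⟨x, y, hxy, -⟩
      exact hxy.edge_mem
  obtain ⟨col, hlast, hcol⟩ := hC.exists_coloring
  have hCl : ∀ e : E(G), G.IsLink e (C.tail e) (C.head e) := by
    intro e
    have h1 := hC.ends_eq e
    rw [Sym2.eq_iff] at h1
    rcases h1 with ⟨h1, h2⟩ | ⟨h1, h2⟩
    · rw [h1, h2]; exact ha e
    · rw [h1, h2]; exact (ha e).symm
  rcases Set.eq_empty_or_nonempty V(G) with hemp | ⟨v₀, -⟩
  · have hempty : ∀ {K : Graph α β}, G.IsComponent K → False := fun hK =>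
      hK.1.2.1.ne_empty (Set.subset_empty_iff.1 (hemp ▸ hK.1.1.vertexSet_mono))
    refine ⟨fun _ => G, ⟨fun _ => .rfl, fun e he => ?_⟩, fun _ K hK => (hempty hK).elim, 0,
      ?_, fun K hK => (hempty hK).elim⟩
    · exact absurd (ha ⟨e, he⟩).left_mem (by simp [hemp])
    · rintro C hCG ⟨n, v, -, -, -, hVC, -⟩
      have : v 0 ∈ V(G) := hCG.vertexSet_mono (hVC ▸ Set.mem_range_self 0)
      simp [hemp] at this
  set t : β → α := fun e => if he : e ∈ E(G) then C.tail ⟨e, he⟩ else v₀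
  set h : β → α := fun e => if he : e ∈ E(G) then C.head ⟨e, he⟩ else v₀
  have htG : ∀ e : E(G), t e = C.tail e := fun e => by simp [t]
  have hhG : ∀ e : E(G), h e = C.head e := fun e => by simp [h]
  set F : Fin (k + 1) → Graph α β := fun i => G.restrict (Subtype.val '' {e | col e = i})
  have hEF : ∀ i e, e ∈ E(F i) ↔ ∃ f, col f = i ∧ f.1 = e := by
    intro i e
    simp only [F, restrict, Set.mem_inter_iff, Set.mem_image, Set.mem_ofPred_eq]
    constructor
    · exact fun h => h.2
    · rintro ⟨f, hf, rfl⟩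
      exact ⟨f.2, f, hf, rfl⟩
  have hth : ∀ i, ∀ e ∈ E(F i), (F i).IsLink e (t e) (h e) := by
    intro i e he
    have hle : F i ≤ G := restrict_le
    rw [hle.isLink_iff he]
    obtain ⟨f, -, rfl⟩ := (hEF i e).1 he
    rw [htG, hhG]
    exact hCl f
  have hinj : ∀ i, Set.InjOn t E(F i) := by
    intro i e he f hf hef
    obtain ⟨e, hei, rfl⟩ := (hEF i _).1 he
    obtain ⟨f, hfi, rfl⟩ := (hEF i _).1 hf
    rw [htG, htG] at hef
    rw [hcol e f (hei.trans hfi.symm) (Subtype.ext hef)]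
  have hred : ∀ e ∈ E(F (Fin.last k)), ∃ f, C.red f ∧ f.1 = e := by
    intro e he
    obtain ⟨f, hf, rfl⟩ := (hEF _ _).1 he
    exact ⟨f, (hlast f).1 hf, rfl⟩
  have hne : ∀ e ∈ E(F (Fin.last k)), ∀ f ∈ E(F (Fin.last k)), t e ≠ h f := by
    intro e he f hf hef
    obtain ⟨e, her, rfl⟩ := hred e he
    obtain ⟨f, hfr, rfl⟩ := hred f hf
    rw [htG, hhG] at hef
    exact hC.star.tail_ne_head e f her hfr (Subtype.ext hef)
  refine ⟨F, ⟨fun i => ⟨restrict_le, rfl⟩, fun e he => ⟨col ⟨e, he⟩, ?_, ?_⟩⟩,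
    fun i => isPseudoforest_of_injOn (hth i) (hinj i), Fin.last k,
    isForest_of_tail_ne_head (hth _) (hinj _) hne, fun K hK => ⟨?_, ?_⟩⟩
  · exact (hEF _ _).2 ⟨_, rfl, rfl⟩
  · rintro i hi
    obtain ⟨f, hf, rfl⟩ := (hEF _ _).1 hi
    exact hf.symm
  · obtain ⟨c, hVK, hEK⟩ := hK.exists_center (hth _) (hinj _) hne
    have hcG : c ∈ V(G) := hK.1.1.vertexSet_mono (hVK ▸ Set.mem_insert _ _)
    refine le_trans ?_ (hC.star.card_le ⟨c, hcG⟩)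
    rw [hEK, ← Set.ncard_coe_finset, ← Set.ncard_image_of_injective _ Subtype.val_injective]
    refine Set.ncard_le_ncard ?_ (Set.toFinite _)
    rintro e ⟨he, hec⟩
    obtain ⟨f, hfr, rfl⟩ := hred e he
    rw [hhG] at hec
    exact ⟨f, by simpa using ⟨hfr, Subtype.ext hec⟩, rfl⟩
  · exact hK.isStar (hE.subset restrict_le.edgeSet_mono) (hth _) (hinj _) hne
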